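/- **Setting.** Let $l\ge 3$. Let $A=(a_{ij})_{0\le i,j\le l}$ be the generalized Cartan matrix of type $B_l^{(1)}$: $a_{ii}=2$; vertices $0$ and $1$ are both joined to $2$, and $i$ is joined to $i+1$ for $2\le i<l$; $a_{ij}=-1$ for joined $i,j$ except that $a_{l,l-1}=-2$; all other entries are $0$. Let $W$ be its Weyl group, i.e. the group generated by $s_0,\dots,s_l$ with relations $s_i^2=1$ and $(s_is_j)^{m_{ij}}=1$, where $m_{ij}=2,3,4$ according as $a_{ij}a_{ji}=0,1,2$; let $W_0$ be the subgroup generated by $s_1,\dots,s_l$. Let $E=\{(x,y)\in\mathbb Z^2: 0\le x<l,\ x\equiv y \bmod 2\}$ with the order $(x,y)\le(x',y')$ iff $|x-x'|\le y'-y$. Label $(x,y)$ by $x+1$ if $x\ge1$, and label $(0,y)$ by $1$ if $y\equiv0\bmod 4$ and by $0$ if $y\equiv 2\bmod4$. An ideal is a subset closed downwards; a proper ideal is an ideal $F$ such that for each label $p$, some but not all elements with label $p$ lie in $F$. Let $\mathcal B$ be the set of proper ideals. For $F\in\mathcal B$ and a label $i$, let $S_i(F)$ be obtained from $F$ by removing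 the element labelled $i$ whose removal leaves an ideal, if there is one; otherwise by adding the element labelled $i$ whose addition leaves an ideal, if there is one; otherwise $S_i(F)=F$. Write $E(0,t)=(0,4t-2)$. Let $h(F)$ be the largest $t$ with $E(0,t)\in F$, let $\mathcal B_0=\{F\in\mathcal B:h(F)=0\}$, and let $\phi(x,y)=(x,y+4)$. To $F\in\mathcal B_0$ put $G=F\setminus\{a: a\le E(0,0)\}$; let $f(-1)=0$ and, for $0\le i<l$, let $f(i)=\max\{y:(i,y)\in G\}+1$, or $f(i)=-i-1$ if there is no such $y$. The string $\sigma(F)\in\{+,-\}^l$ has $i$-th symbol $+$ if $f(i-1)>f(i-2)$ and $-$ otherwise $(1\le i\le l)$. Finally, for $F\in\mathcal B$ let $\omega(F)=\bigl(h(F),\sigma(\phi^{-h(F)}(F))\bigr)\in\mathbb Z\times\{+,-\}^l$. **Proposition 7.8.** $E$ is a full heap over the Dynkin diagram of $A$: (a) intervals of $E$ are finite, elements with equal or adjacent labels are comparable, and the order is the transitive closure of its restriction to pairs with equal or adjacent labels; (b) the elements with a given label form a nonempty chain unbounded in both directions, and for every $a\in E$ and every label $q$ adjacent to that of $a$, some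 element labelled $q$ covers or is covered by $a$; (c) $\sum_{a<c<b}a_{p,\varepsilon(c)}=-2$ for any two consecutive elements $a<b$ with the same label $p$, where $\varepsilon(c)$ is the label of $c$. The group $W_0$ is the (finite) Weyl group of type $B_l$ on the generators $s_1,\dots,s_l$. The maps $\sigma:\mathcal B_0\to\{+,-\}^l$ and $\omega:\mathcal B\to\mathbb Z\times\{+,-\}^l$ are bijections. There is an action of $W$ on $\mathcal B$ with $s_i\cdot F=S_i(F)$ for $0\le i\le l$, and: 1. $W_0$ preserves $\mathcal B_0$, and the action of $W_0$ on $\{+,-\}^l$ induced through $\sigma$ is transitive and faithful. For $1\le i<l$, $s_i$ exchanges the symbols at positions $i$ and $i+1$; $s_l$ changes the symbol at position $l$. 2. The action of $W$ on $\mathbb Z\times\{+,-\}^l$ induced through $\omega$ is faithful and extends the action in 1: $w\cdot(t,\mathbf s)=(t,w\cdot\mathbf s)$ for $w\in W_0$ (in particular $s_i$ acts as $(\mathrm{id},s_i)$ for $1\le i\le l$). With $\mathbf s'$ denoting a string of length $l-2$, $$\begin{aligned} s_0\cdot(t,\,{+}{+}\mathbf s')&=(t+1,\,{-}{-}\mathbf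 s'), & s_0\cdot(t,\,{-}{-}\mathbf s')&=(t-1,\,{+}{+}\mathbf s'),\\ s_0\cdot(t,\,{+}{-}\mathbf s')&=(t,\,{+}{-}\mathbf s'), & s_0\cdot(t,\,{-}{+}\mathbf s')&=(t,\,{-}{+}\mathbf s'). \end{aligned}$$ -/

import Mathlib

namespace FullHeap

/-! ### Generalized Cartan matrices, Weyl groups, labelled heaps -/

section General

variable {P : Type*}

/-- The Coxeter matrix attached to a generalized Cartan matrix `A` : the order of `s_p s_q`
(for `p ≠ q`) is `2`, `3`, `4`, `6`, or infinite (encoded by `0`) according as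
`a_{pq} a_{qp}` is `0`, `1`, `2`, `3`, or anything else. -/
def coxeterMatrix [DecidableEq P] (A : Matrix P P ℤ) : CoxeterMatrix P where
  M := Matrix.of fun p q =>
    if p = q then 1
    else if A p q * A q p = 0 then 2
    else if A p q * A q p = 1 then 3
    else if A p q * A q p = 2 then 4
    else if A p q * A q p = 3 then 6
    else 0
  isSymm := by
    ext p q
    simp only [Matrix.transpose_apply, Matrix.of_apply, mul_comm (A q p), eq_comm (a := q)]
  diagonal p := by simp
  off_diagonal p q h := by
    simp only [Matrix.of_apply, if_neg h]
    split_ifs <;> decide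

/-- Adjacency of two (distinct) vertices in the Dynkin diagram of `A`. -/
def Adjacent (A : Matrix P P ℤ) (p q : P) : Prop := p ≠ q ∧ A p q ≠ 0

/-- The relation "equal or adjacent" on vertices: the complement of
"distinct and not adjacent". -/
def Concurrent (A : Matrix P P ℤ) (p q : P) : Prop := p = q ∨ Adjacent A p q

variable {E : Type*} [PartialOrder E]

/-- `(E, ≤, ε)` is a labelled heap over the Dynkin diagram of `A`. -/
structure IsLabelledHeap (A : Matrix P P ℤ) (ε : E → P) : Prop where
  locallyFinite : ∀ a b : E, (Set.Icc a b).Finite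
  comparable : ∀ a b : E, Concurrent A (ε a) (ε b) → a ≤ b ∨ b ≤ a
  generated : ∀ a b : E,
    a ≤ b ↔ Relation.TransGen (fun c d : E => c ≤ d ∧ Concurrent A (ε c) (ε d)) a b

/-- A fibred heap: every fibre of the labelling is a (nonempty) chain unbounded in both directions,
and every element is in a covering relation with an element of each adjacent label. -/
structure IsFibred (A : Matrix P P ℤ) (ε : E → P) : Prop extends IsLabelledHeap A ε where
  nonempty : ∀ p : P, ∃ a : E, ε a = p
  unbounded_above : ∀ a : E, ∃ b : E, ε b = ε a ∧ a < b
  unbounded_below : ∀ a : E, ∃ b : E, ε b = ε a ∧ b < a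
  exists_cover : ∀ (a : E) (q : P), Adjacent A (ε a) q → ∃ b : E, ε b = q ∧ (b ⋖ a ∨ a ⋖ b)

/-- A full heap: a fibred heap such that, for two consecutive elements `a < b` with the same
label `p`, the entries `a_{p, ε(c)}` over the open interval `(a, b)` add up to `-2`
(the intervals being finite, the sum is a finite one). -/
structure IsFull (A : Matrix P P ℤ) (ε : E → P) : Prop extends IsFibred A ε where
  sum_eq : ∀ a b : E, a < b → ε a = ε b → (∀ c ∈ Set.Ioo a b, ε c ≠ ε a) →
    ∑ᶠ c ∈ Set.Ioo a b, A (ε a) (ε c) = -2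

/-- A proper ideal: an order ideal meeting every fibre of the labelling in a nonempty
proper subset of the fibre. -/
structure IsProperIdeal (ε : E → P) (F : Set E) : Prop where
  isLowerSet : IsLowerSet F
  nonempty : F.Nonempty
  ne_univ : F ≠ Set.univ
  inter_nonempty : ∀ p : P, (F ∩ ε ⁻¹' {p}).Nonempty
  inter_ssubset : ∀ p : P, F ∩ ε ⁻¹' {p} ⊂ ε ⁻¹' {p}

/-- The set of proper ideals of `(E, ≤, ε)`. -/
def ProperIdeal (ε : E → P) : Type _ := {F : Set E // IsProperIdeal ε F}

/-- The elements with label `p` that can be removed from the ideal `I`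
(there is at most one in a full heap). -/
def removable (ε : E → P) (p : P) (I : Set E) : Set E :=
  {a | ε a = p ∧ a ∈ I ∧ IsLowerSet (I \ {a})}

/-- The elements with label `p` that can be added to the ideal `I`
(there is at most one in a full heap). -/
def addable (ε : E → P) (p : P) (I : Set E) : Set E :=
  {a | ε a = p ∧ a ∉ I ∧ IsLowerSet (I ∪ {a})}

open Classical in
/-- The operator `S_p` on ideals: remove the element with label `p` if possible, otherwise add
an element with label `p` if possible, otherwise do nothing. -/
noncomputable def reflect (ε : E → P) (p : P) (I : Set E) : Set E :=
  if (removable ε p I).Nonempty then I \ removable ε p I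
  else if (addable ε p I).Nonempty then I ∪ addable ε p I
  else I

end General

/-! ### Type affine `B` -/

/-- The generalized Cartan matrix of type `B_l^{(1)}` (`l ≥ 3`) on the vertices `0, 1, …, l`:
both `0` and `1` are joined to `2`, the vertices `2, …, l-1` form a simply laced path, and
`l-1` and `l` are joined by a double edge with an arrow towards `l` (`a_{l,l-1} = -2`,
`a_{l-1,l} = -1`). -/
def cartanAffineB (l : ℕ) : Matrix (Fin (l + 1)) (Fin (l + 1)) ℤ :=
  Matrix.of fun i j =>
    if i = j then 2
    else if (i : ℕ) = l ∧ (j : ℕ) + 1 = l then -2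
    else if ((i : ℕ) = 0 ∧ (j : ℕ) = 2) ∨ ((i : ℕ) = 2 ∧ (j : ℕ) = 0) then -1
    else if (0 < (i : ℕ) ∧ (i : ℕ) + 1 = j) ∨ (0 < (j : ℕ) ∧ (j : ℕ) + 1 = i) then -1
    else 0

/-- The affine Weyl group `W` of type `B_l^{(1)}`. -/
abbrev AffineWeyl (l : ℕ) : Type := (coxeterMatrix (cartanAffineB l)).Group

/-- The generator `s_i` of `W`, for `0 ≤ i ≤ l`. -/
abbrev s {l : ℕ} (i : Fin (l + 1)) : AffineWeyl l := (coxeterMatrix (cartanAffineB l)).simple i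

/-- The subgroup `W_0` of `W` generated by `s_1, …, s_l`. -/
def finiteWeyl (l : ℕ) : Subgroup (AffineWeyl l) :=
  Subgroup.closure (Set.range fun i : Fin l => s i.succ)

/-- The generators of `W_0`: `s₀ i` is `s_{i+1}`, where `i` runs through `0, …, l-1`. -/
def s₀ {l : ℕ} (i : Fin l) : finiteWeyl l :=
  ⟨s i.succ, Subgroup.subset_closure ⟨i, rfl⟩⟩

/-- The underlying set of the spin heap of type `B_l^{(1)}`: the points `(x, y)` of the grid with
`0 ≤ x < l` and `x ≡ y` modulo `2`. -/
@[ext]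
structure SpinHeap (l : ℕ) where
  x : Fin l
  y : ℤ
  even_sub : Even ((x : ℤ) - y)

namespace SpinHeap

variable {l : ℕ}

/-- The order of the spin heap: for `l ≥ 2` it is generated by the covering relations
`(x, y) < (x ± 1, y + 1)`. -/
instance : PartialOrder (SpinHeap l) where
  le a b := |(a.x : ℤ) - (b.x : ℤ)| ≤ b.y - a.y
  le_refl a := by simp
  le_trans a b c hab hbc := by
    have h := abs_sub_le (a.x : ℤ) (b.x : ℤ) (c.x : ℤ)
    linarith
  le_antisymm a b hab hba := by
    have h1 := abs_le.mp hab
    have h2 := abs_le.mp hba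
    ext <;> omega

/-- The labelling: column `x ≥ 1` carries the label `x + 1`, and in column `0` the labels `1`
(at heights `y ≡ 0` modulo `4`) and `0` (at heights `y ≡ 2` modulo `4`) alternate. -/
def label (a : SpinHeap l) : Fin (l + 1) :=
  if (a.x : ℕ) = 0 ∧ ¬ (4 : ℤ) ∣ a.y then 0 else a.x.succ

/-- `a.IsZero t` says that `a` is the element `E(0, t)`, i.e. the `t`-th element of the chain of
elements with label `0`, located at `(0, 4t - 2)`. -/
def IsZero (a : SpinHeap l) (t : ℤ) : Prop := (a.x : ℕ) = 0 ∧ a.y = 4 * t - 2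

/-- The height of an ideal: the maximal `t` with `E(0, t) ∈ F` (which exists if `F` is proper). -/
noncomputable def height (F : Set (SpinHeap l)) : ℤ := sSup {t : ℤ | ∃ a ∈ F, a.IsZero t}

/-- The power `φ ^ k` of the fundamental automorphism `φ : (x, y) ↦ (x, y + 4)`. -/
def shift (k : ℤ) (a : SpinHeap l) : SpinHeap l where
  x := a.x
  y := a.y + 4 * k
  even_sub := by
    have h := a.even_sub
    rw [Int.even_iff] at h ⊢
    omega

/-- The principal ideal `⟨E(0, 0)⟩`. -/
def baseIdeal : Set (SpinHeap l) := {a | ∃ b : SpinHeap l, b.IsZero 0 ∧ a ≤ b}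

open Classical in
/-- `g(G, i)` is `max {y : (i, y) ∈ G} + 1`, and `-i - 1` if there is no such `y`. -/
noncomputable def top (G : Set (SpinHeap l)) (i : Fin l) : ℤ :=
  if {y : ℤ | ∃ a ∈ G, a.x = i ∧ a.y = y}.Nonempty then
    sSup {y : ℤ | ∃ a ∈ G, a.x = i ∧ a.y = y} + 1
  else -(i : ℤ) - 1

/-- The binary path `f : {-1, 0, …, l-1} → ℤ` of `G`, with `f(-1) = 0` and `f(i) = g(G, i)` for
`i ≥ 0`. The argument is shifted by one: `path G j` is `f(j - 1)` for `0 ≤ j ≤ l`. -/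
noncomputable def path (G : Set (SpinHeap l)) : Fin (l + 1) → ℤ :=
  Fin.cons 0 (top G)

end SpinHeap

/-- Strings of length `l` in the symbols `+` and `-`, encoded as the units `1` and `-1` of `ℤ`;
the symbol at position `i + 1` (positions being counted from `1`) is the value at `i`. -/
abbrev SignString (l : ℕ) : Type := Fin l → ℤˣ

/-- The string of a binary path `f`: the `i`-th symbol (`1 ≤ i ≤ l`) is `+` if
`f(i - 1) > f(i - 2)` and `-` otherwise. -/
def signs {l : ℕ} (f : Fin (l + 1) → ℤ) : SignString l :=
  fun i => if f i.castSucc < f i.succ then 1 else -1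

/-- The set of proper ideals of the spin heap. -/
abbrev Ideals (l : ℕ) : Type := ProperIdeal (SpinHeap.label (l := l))

/-- The string of an ideal `F` of height `0`, obtained from the binary path of the ideal
`F \ ⟨E(0, 0)⟩` of the subheap `E_0`. -/
noncomputable def stringOf {l : ℕ} (F : Set (SpinHeap l)) : SignString l :=
  signs (SpinHeap.path (F \ SpinHeap.baseIdeal))

/-- The map `I ↦ (h(I), string of φ^{-h(I)}(I))` from proper ideals to `ℤ × {+, -}^l`. -/
noncomputable def coords {l : ℕ} (I : Ideals l) : ℤ × SignString l :=
  (SpinHeap.height I.1,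
    stringOf (SpinHeap.shift (-SpinHeap.height I.1) '' I.1))

end FullHeap

open FullHeap

/-! Everything is transported to pairs `(t, f)` of an integer and a sign string. Inside a proper
ideal each column has a topmost element. Comparability of neighbouring columns together with parity
forces consecutive tops to differ by exactly `±1`, so an ideal is a lattice path. It is recorded by
its steps `f` and by the integer `t` that fixes the virtual starting height `4t - 1` in column `-1`.
This gives both bijections (`exists_eq_profileIdeal`, `stringOf_profileIdeal`, `coords_of_eq`).

Send `(t, f)` to the weight `∑ f_j e_j + 2tδ`. The simple reflections of the affine root system
preserve the set of these weights, and this defines an operator on pairs for each generator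
(`weight_pairStep`). The Coxeter relations for these operators are inherited from the reflections.
The pairing `c` of a weight with the coroot of `s_i` is `2`, `-2` or `0`. Correspondingly one
element of the ideal is removed, one is added, or neither is possible, so the operator is `S_i`
(`reflect_profileIdeal`).

Faithfulness on pairs rests on faithfulness of the reflection representation. The latter follows
from the classical fact that `w α_i` is positive whenever `ℓ(w s_i) > ℓ(w)` (`height_rep_root_pos`).
Here positivity is measured by a single linear functional. The same fact, applied to the type `B_l`
system on the same lattice, identifies `W_0`. -/

namespace FullHeap

/-! ### Faithfulness of reflection representations with bonds 2, 3, 4 -/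

/-- A reflection representation of the Coxeter group of `M` on a lattice `V`, given by simple roots
and coroots, in which all orders `m_{ij}` (`i ≠ j`) are `2`, `3` or `4`, together with a linear
functional which is positive on the simple roots. -/
structure ReflectionData {B : Type*} (M : CoxeterMatrix B) (V : Type*) [AddCommGroup V] where
  root : B → V
  coroot : B → V →ₗ[ℤ] ℤ
  height : V →ₗ[ℤ] ℤ
  height_pos : ∀ i, 0 < height (root i)
  coroot_root_self : ∀ i, coroot i (root i) = 2
  coroot_root : ∀ i j, i ≠ j →
    (M i j = 2 ∧ coroot i (root j) = 0 ∧ coroot j (root i) = 0) ∨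
    (M i j = 3 ∧ coroot i (root j) = -1 ∧ coroot j (root i) = -1) ∨
    (M i j = 4 ∧ coroot i (root j) = -1 ∧ coroot j (root i) = -2) ∨
    (M i j = 4 ∧ coroot i (root j) = -2 ∧ coroot j (root i) = -1)

namespace ReflectionData

variable {B V : Type*} {M : CoxeterMatrix B} [AddCommGroup V] (R : ReflectionData M V)

/-- The reflection `v ↦ v - ⟨v, α_i^∨⟩ α_i`. -/
def reflection (i : B) : Module.End ℤ V :=
  LinearMap.id - (R.coroot i).smulRight (R.root i)

@[simp]
theorem reflection_apply (i : B) (v : V) :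
    R.reflection i v = v - R.coroot i v • R.root i := rfl

/-- Only the pairings between `α_i` and `α_j` enter `(r_i r_j)^m v`, so each of the possible values
of `m` is a direct expansion. -/
theorem isLiftable : M.IsLiftable R.reflection := by
  intro i j
  by_cases hij : i = j
  · subst hij
    ext v
    simp only [CoxeterMatrix.diagonal, pow_one, Module.End.mul_apply, reflection_apply, map_sub,
      map_smul, R.coroot_root_self, Module.End.one_apply]
    module
  · have hi := R.coroot_root_self i
    have hj := R.coroot_root_self j
    rcases R.coroot_root i j hij with ⟨hM, h1, h2⟩ | ⟨hM, h1, h2⟩ | ⟨hM, h1, h2⟩ | ⟨hM, h1, h2⟩ <;>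
    · ext v
      simp only [hM, pow_succ, pow_zero, one_mul, Module.End.mul_apply, reflection_apply, map_sub,
        map_smul, h1, h2, hi, hj, Module.End.one_apply]
      module

/-- The reflection representation. -/
noncomputable def rep : M.Group →* Module.End ℤ V :=
  M.toCoxeterSystem.lift ⟨R.reflection, R.isLiftable⟩

theorem rep_simple (i : B) : R.rep (M.toCoxeterSystem.simple i) = R.reflection i :=
  M.toCoxeterSystem.lift_apply_simple R.isLiftable i

theorem rep_mul_simple_apply (w : M.Group) (i : B) (v : V) :
    R.rep (w * M.toCoxeterSystem.simple i) v =
      R.rep w v - R.coroot i v • R.rep w (R.root i) := by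
  rw [map_mul, Module.End.mul_apply, rep_simple, reflection_apply, map_sub, map_smul]

/-- An element `w` with `ℓ(w s_i) > ℓ(w)` maps the simple root `α_i` to a positive root. -/
theorem height_rep_root_pos (w : M.Group) (i : B)
    (hi : ¬ M.toCoxeterSystem.IsRightDescent w i) : 0 < R.height (R.rep w (R.root i)) := by
  set cs := M.toCoxeterSystem with hcs
  induction hn : cs.length w using Nat.strong_induction_on generalizing w i with
  | _ n ih =>
  subst hn
  by_cases hw : w = 1
  · subst hw
    simpa using R.height_pos i
  obtain ⟨j, hj⟩ := cs.exists_rightDescent_of_ne_one hw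
  have hij : i ≠ j := fun h => hi (h ▸ hj)
  have key : ∀ (u : M.Group) (k : B), cs.IsRightDescent u k →
      cs.length (u * cs.simple k) < cs.length u ∧
      ¬ cs.IsRightDescent (u * cs.simple k) k ∧ u = u * cs.simple k * cs.simple k := by
    intro u k hk
    exact ⟨hk, (cs.isRightDescent_iff_not_isRightDescent_mul).1 hk, by simp⟩
  have hrep : ∀ (u : M.Group) (k : B) (v : V), R.rep (u * cs.simple k) v =
      R.rep u v - R.coroot k v • R.rep u (R.root k) := R.rep_mul_simple_apply
  have hii := R.coroot_root_self i
  have hjj := R.coroot_root_self j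
  obtain ⟨hl1, hd1, e1⟩ := key w j hj
  generalize w * cs.simple j = w1 at hl1 hd1 e1
  have hp1j := ih _ hl1 w1 j hd1 rfl
  have hlen : cs.length w < cs.length (w * cs.simple i) := by
    have := cs.length_mul_simple_ne w i
    unfold CoxeterSystem.IsRightDescent at hi
    omega
  have hlenle : ∀ (u : M.Group) (k : B), cs.length (u * cs.simple k) ≤ cs.length u + 1 := by
    intro u k
    simpa using cs.length_mul_le u (cs.simple k)
  -- Letters `j, i, j, i` are stripped from the right of `w` for as long as they are descents. When
  -- this stops at some `u`, both `u α_i` and `u α_j` are positive by induction, and `w α_i` is a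
  -- nonzero combination of them with nonnegative coefficients.
  by_cases h1 : cs.IsRightDescent w1 i
  swap
  · have hp1i := ih _ hl1 w1 i h1 rfl
    rw [e1, hrep, map_sub, map_smul, smul_eq_mul]
    rcases R.coroot_root i j hij with ⟨-, -, h⟩ | ⟨-, -, h⟩ | ⟨-, -, h⟩ | ⟨-, -, h⟩ <;>
    · rw [h]
      linarith
  obtain ⟨hl2, hd2, e2⟩ := key w1 i h1
  generalize w1 * cs.simple i = w2 at hl2 hd2 e2
  have hp2i := ih _ (hl2.trans hl1) w2 i hd2 rfl
  have braid := cs.wordProd_braidWord_eq i j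
  simp only [CoxeterSystem.braidWord, M.symmetric j i] at braid
  -- Now `w s_i = w2 s_i s_j s_i`. If `s_i` and `s_j` commuted this would be `w2 s_j`, too short for
  -- an element longer than `w`. The exclusions of order `3` and `4` below follow the same pattern,
  -- with one more letter each time.
  have hM2 : M i j ≠ 2 := by
    intro hM
    simp only [hM, CoxeterSystem.alternatingWord, List.concat_eq_append, List.nil_append,
      List.cons_append, cs.wordProd_cons, cs.wordProd_nil, mul_one] at braid
    have : w * cs.simple i = w2 * cs.simple j := by
      rw [e1, e2, mul_assoc w2, braid]
      simp [mul_assoc]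
    have h3 := hlenle w2 j
    rw [this] at hlen
    omega
  by_cases h2 : cs.IsRightDescent w2 j
  swap
  · have hp2j := ih _ (hl2.trans hl1) w2 j h2 rfl
    rw [e1, e2]
    simp only [hrep, map_sub, map_smul, smul_eq_mul]
    rcases R.coroot_root i j hij with ⟨h, -⟩ | ⟨-, h, h'⟩ | ⟨-, h, h'⟩ | ⟨-, h, h'⟩
    · exact absurd h hM2
    all_goals
      rw [h, h', hii]
      linarith
  obtain ⟨hl3, hd3, e3⟩ := key w2 j h2
  generalize w2 * cs.simple j = w3 at hl3 hd3 e3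
  have hM3 : M i j ≠ 3 := by
    intro hM
    simp only [hM, CoxeterSystem.alternatingWord, List.concat_eq_append, List.nil_append,
      List.cons_append, cs.wordProd_cons, cs.wordProd_nil, mul_one] at braid
    have : w * cs.simple i = w3 * cs.simple i * cs.simple j := by
      rw [e1, e2, e3, mul_assoc w3, mul_assoc w3, mul_assoc (cs.simple j), braid]
      simp [mul_assoc]
    have h3 := hlenle w3 i
    have h4 := hlenle (w3 * cs.simple i) j
    rw [this] at hlen
    omega
  have hp3j := ih _ (hl3.trans (hl2.trans hl1)) w3 j hd3 rfl
  by_cases h3 : cs.IsRightDescent w3 i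
  swap
  · have hp3i := ih _ (hl3.trans (hl2.trans hl1)) w3 i h3 rfl
    rw [e1, e2, e3]
    simp only [hrep, map_sub, map_smul, smul_eq_mul]
    rcases R.coroot_root i j hij with ⟨h, -⟩ | ⟨h, -⟩ | ⟨-, h, h'⟩ | ⟨-, h, h'⟩
    · exact absurd h hM2
    · exact absurd h hM3
    all_goals
      rw [h, h', hii, hjj]
      linarith
  -- Four letters have been stripped, so `w` ends in the longest element of the dihedral group of
  -- order `8`. That element can also be written ending in `s_i`, against `ℓ(w s_i) > ℓ(w)`.
  exfalso
  obtain ⟨hl4, -, e4⟩ := key w3 i h3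
  generalize w3 * cs.simple i = w4 at hl4 e4
  have hM : M i j = 4 := by
    rcases R.coroot_root i j hij with ⟨h, -⟩ | ⟨h, -⟩ | ⟨h, -⟩ | ⟨h, -⟩
    · exact absurd h hM2
    · exact absurd h hM3
    all_goals exact h
  simp only [hM, CoxeterSystem.alternatingWord, List.concat_eq_append, List.nil_append,
    List.cons_append, cs.wordProd_cons, cs.wordProd_nil, mul_one] at braid
  have : w * cs.simple i = w4 * cs.simple j * cs.simple i * cs.simple j := by
    have : w = w4 * (cs.simple i * (cs.simple j * (cs.simple i * cs.simple j))) := by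
      rw [e1, e2, e3, e4]
      simp only [mul_assoc]
    rw [this, braid]
    simp [mul_assoc]
  have h5 := hlenle w4 j
  have h6 := hlenle (w4 * cs.simple j) i
  have h7 := hlenle (w4 * cs.simple j * cs.simple i) j
  rw [this] at hlen
  omega

/-- An element of the Coxeter group mapping all simple roots to positive roots is trivial. -/
theorem eq_one_of_height_pos (w : M.Group)
    (hw : ∀ i, 0 < R.height (R.rep w (R.root i))) : w = 1 := by
  by_contra h
  obtain ⟨i, hi⟩ := M.toCoxeterSystem.exists_rightDescent_of_ne_one h
  -- For a right descent `i` of `w`, the element `w s_i` sends `α_i` to a positive vector; but `w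
  -- s_i α_i = -w α_i`.
  have h1 := R.height_rep_root_pos _ i
    ((M.toCoxeterSystem.isRightDescent_iff_not_isRightDescent_mul).1 hi)
  rw [R.rep_mul_simple_apply, R.coroot_root_self, map_sub, map_smul, smul_eq_mul] at h1
  linarith [hw i]

/-- It suffices to fix the simple roots, which need not span `V`; in the application `V` is the
large lattice `ℕ → ℤ`. -/
theorem eq_one_of_rep_root_eq (w : M.Group) (hw : ∀ i, R.rep w (R.root i) = R.root i) : w = 1 :=
  R.eq_one_of_height_pos w fun i => by
    rw [hw]
    exact R.height_pos i

/-- The reflection representation is faithful. -/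
theorem rep_injective : Function.Injective R.rep := by
  rw [injective_iff_map_eq_one]
  intro w hw
  exact R.eq_one_of_rep_root_eq w fun i => by rw [hw, Module.End.one_apply]

end ReflectionData

/-! ### The reflection representation in type affine `B` -/

section AffineRoots

variable (l : ℕ)

/-- The simple roots of type `B_l^{(1)}` in the lattice with basis `e_0, …, e_{l-1}, δ`, where `δ`
is the basis vector with index `l`. -/
def affineRoot (i : ℕ) : ℕ → ℤ :=
  if i = 0 then Pi.single l 1 - Pi.single 0 1 - Pi.single 1 1
  else if i = l then Pi.single (l - 1) 1
  else Pi.single (i - 1) 1 - Pi.single i 1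

/-- The simple coroots of type `B_l^{(1)}`. -/
def affineCoroot (i : ℕ) : (ℕ → ℤ) →ₗ[ℤ] ℤ :=
  let e (n : ℕ) : (ℕ → ℤ) →ₗ[ℤ] ℤ := LinearMap.proj n
  if i = 0 then - e 0 - e 1 else if i = l then (2 : ℤ) • e (l - 1) else e (i - 1) - e i

theorem affineRoot_apply (i n : ℕ) : affineRoot l i n =
    if i = 0 then (if n = l then 1 else 0) - (if n = 0 then 1 else 0) - (if n = 1 then 1 else 0)
    else if i = l then (if n = l - 1 then 1 else 0)
    else (if n = i - 1 then 1 else 0) - (if n = i then 1 else 0) := by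
  unfold affineRoot
  by_cases h0 : i = 0
  · simp only [if_pos h0, Pi.sub_apply, Pi.single_apply]
  by_cases h1 : i = l
  · simp only [if_neg h0, if_pos h1, Pi.single_apply]
  · simp only [if_neg h0, if_neg h1, Pi.sub_apply, Pi.single_apply]

theorem affineCoroot_apply (i : ℕ) (v : ℕ → ℤ) : affineCoroot l i v =
    if i = 0 then - v 0 - v 1 else if i = l then 2 * v (l - 1) else v (i - 1) - v i := by
  unfold affineCoroot
  split_ifs <;> simp

/-- Every coroot vanishes on `δ`, so `δ` does not affect the pairings. It is nevertheless
indispensable: without it `α_0 + (e_0 + e_1)` would be zero, and no functional could be positive on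
all simple roots. -/
theorem affineCoroot_affineRoot (hl : 3 ≤ l) (i j : Fin (l + 1)) :
    affineCoroot l i (affineRoot l j) = cartanAffineB l i j := by
  obtain ⟨i, hi⟩ := i
  obtain ⟨j, hj⟩ := j
  simp only [affineCoroot_apply, affineRoot_apply, cartanAffineB, Matrix.of_apply, Fin.mk.injEq]
  grind (splits := 50)

/-- A linear functional which takes the value `1` on all simple roots of type `B_l^{(1)}`. -/
def affineHeight : (ℕ → ℤ) →ₗ[ℤ] ℤ :=
  ∑ n ∈ Finset.range (l + 1), (if n = l then 2 * (l : ℤ) else l - n) • LinearMap.proj n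

theorem affineHeight_single (n : ℕ) (hn : n ≤ l) :
    affineHeight l (Pi.single n 1) = if n = l then 2 * (l : ℤ) else l - n := by
  simp only [affineHeight, LinearMap.sum_apply, LinearMap.smul_apply, LinearMap.proj_apply,
    Pi.single_apply, smul_eq_mul]
  rw [Finset.sum_eq_single n]
  · simp
  · intro b _ hb
    simp [hb]
  · intro h
    simp at h
    omega

/-- Giving `e_n` the height `l - n` makes `e_{n-1} - e_n` and `e_{l-1}` have height `1`. Then `α_0 =
δ - e_0 - e_1` forces the height of `δ` to be `1 + l + (l - 1) = 2l`. -/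
theorem affineHeight_affineRoot (hl : 3 ≤ l) (i : ℕ) (hi : i ≤ l) :
    affineHeight l (affineRoot l i) = 1 := by
  unfold affineRoot
  split_ifs
  · simp only [map_sub]
    rw [affineHeight_single l l le_rfl, affineHeight_single l 0 (by omega),
      affineHeight_single l 1 (by omega)]
    grind
  · rw [affineHeight_single l _ (by omega)]
    grind
  · simp only [map_sub]
    rw [affineHeight_single l _ (by omega), affineHeight_single l i (by omega)]
    grind

theorem cartanAffineB_cases (hl : 3 ≤ l) (i j : Fin (l + 1)) (hij : i ≠ j) :
    (cartanAffineB l i j = 0 ∧ cartanAffineB l j i = 0) ∨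
    (cartanAffineB l i j = -1 ∧ cartanAffineB l j i = -1) ∨
    (cartanAffineB l i j = -1 ∧ cartanAffineB l j i = -2) ∨
    (cartanAffineB l i j = -2 ∧ cartanAffineB l j i = -1) := by
  obtain ⟨i, hi⟩ := i
  obtain ⟨j, hj⟩ := j
  simp only [cartanAffineB, Matrix.of_apply, Fin.mk.injEq, ne_eq] at hij ⊢
  grind (splits := 30)

theorem coxeterMatrix_apply {P : Type*} [DecidableEq P] (A : Matrix P P ℤ) (p q : P) :
    coxeterMatrix A p q =
      if p = q then 1
      else if A p q * A q p = 0 then 2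
      else if A p q * A q p = 1 then 3
      else if A p q * A q p = 2 then 4
      else if A p q * A q p = 3 then 6
      else 0 := rfl

/-- The reflection representation of the affine Weyl group. -/
def affineData (hl : 3 ≤ l) : ReflectionData (coxeterMatrix (cartanAffineB l)) (ℕ → ℤ) where
  root i := affineRoot l i
  coroot i := affineCoroot l i
  height := affineHeight l
  height_pos i := by
    rw [affineHeight_affineRoot l hl i (by omega)]
    exact one_pos
  coroot_root_self i := by
    rw [affineCoroot_affineRoot l hl]
    simp [cartanAffineB]
  coroot_root i j hij := by
    simp only [affineCoroot_affineRoot l hl, coxeterMatrix_apply, if_neg hij]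
    rcases cartanAffineB_cases l hl i j hij with ⟨h1, h2⟩ | ⟨h1, h2⟩ | ⟨h1, h2⟩ | ⟨h1, h2⟩ <;>
      simp [h1, h2]

/-! ### The subgroup generated by `s_1, …, s_l` as the Weyl group of type `B_l` -/

theorem coxeterMatrix_succ (hl : 3 ≤ l) (i j : Fin l) :
    coxeterMatrix (cartanAffineB l) i.succ j.succ = CoxeterMatrix.B l i j := by
  obtain ⟨i, hi⟩ := i
  obtain ⟨j, hj⟩ := j
  simp only [coxeterMatrix_apply, cartanAffineB, Matrix.of_apply, Fin.succ_mk, Fin.mk.injEq,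
    CoxeterMatrix.B]
  by_cases h : i = j
  · simp [h]
  have h' : j ≠ i := Ne.symm h
  by_cases h1 : i + 1 = j
  · subst h1
    by_cases h2 : i + 2 = l <;> grind
  · by_cases h2 : j + 1 = i
    · subst h2
      by_cases h2 : j + 2 = l <;> grind
    · grind

/-- The restriction of the reflection representation to the generators `s_1, …, s_l`. -/
def finiteData (hl : 3 ≤ l) : ReflectionData (CoxeterMatrix.B l) (ℕ → ℤ) where
  root i := (affineData l hl).root i.succ
  coroot i := (affineData l hl).coroot i.succ
  height := affineHeight l
  height_pos i := (affineData l hl).height_pos i.succ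
  coroot_root_self i := (affineData l hl).coroot_root_self i.succ
  coroot_root i j hij := by
    rw [← coxeterMatrix_succ l hl]
    exact (affineData l hl).coroot_root i.succ j.succ (by simpa using hij)

/-- The relations of type `B_l` hold in `W_0`, which gives a surjection onto it. Followed by the
affine representation, this surjection is the reflection representation of type `B_l`; as that is
faithful, the surjection is injective. -/
theorem exists_mulEquiv_finiteWeyl (hl : 3 ≤ l) :
    ∃ e : (CoxeterMatrix.B l).Group ≃* finiteWeyl l,
      ∀ i : Fin l, e ((CoxeterMatrix.B l).simple i) = s₀ i := by
  have hlift : (CoxeterMatrix.B l).IsLiftable (fun i : Fin l => s₀ i) := by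
    intro i j
    rw [← coxeterMatrix_succ l hl]
    apply Subtype.ext
    exact (coxeterMatrix (cartanAffineB l)).toCoxeterSystem.simple_mul_simple_pow i.succ j.succ
  let φ := (CoxeterMatrix.B l).toCoxeterSystem.lift ⟨_, hlift⟩
  have hφ : ∀ i, φ ((CoxeterMatrix.B l).simple i) = s₀ i :=
    (CoxeterMatrix.B l).toCoxeterSystem.lift_apply_simple hlift
  have hcomp : ((affineData l hl).rep.comp (finiteWeyl l).subtype).comp φ =
      (finiteData l hl).rep := by
    apply (CoxeterMatrix.B l).toCoxeterSystem.ext_simple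
    intro i
    rw [ReflectionData.rep_simple]
    simp only [MonoidHom.comp_apply]
    erw [hφ]
    exact (affineData l hl).rep_simple i.succ
  have hinj : Function.Injective φ := by
    have h := (finiteData l hl).rep_injective
    rw [← hcomp, MonoidHom.coe_comp] at h
    exact h.of_comp
  have hsurj : Function.Surjective φ := by
    rintro ⟨w, hw⟩
    have : finiteWeyl l ≤ ((finiteWeyl l).subtype.comp φ).range := by
      refine (Subgroup.closure_le _).2 ?_
      rintro _ ⟨i, rfl⟩
      exact ⟨(CoxeterMatrix.B l).simple i, congrArg Subtype.val (hφ i)⟩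
    obtain ⟨u, hu⟩ := this hw
    exact ⟨u, Subtype.ext hu⟩
  exact ⟨MulEquiv.ofBijective φ ⟨hinj, hsurj⟩, hφ⟩

end AffineRoots

/-! ### The action of the affine Weyl group on pairs -/

section PairAction

variable {l : ℕ}

/-- The symbol of a string at position `n + 1` as an integer, and `0` out of range. -/
def symbol (f : SignString l) (n : ℕ) : ℤ := if h : n < l then (f ⟨n, h⟩ : ℤ) else 0

theorem symbol_of_lt (f : SignString l) {n : ℕ} (h : n < l) : symbol f n = f ⟨n, h⟩ := dif_pos h

theorem symbol_val (f : SignString l) (i : Fin l) : symbol f i = f i := symbol_of_lt f i.2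

theorem symbol_eq_or (f : SignString l) {n : ℕ} (h : n < l) : symbol f n = 1 ∨ symbol f n = -1 := by
  rw [symbol_of_lt f h]
  rcases Int.units_eq_one_or (f ⟨n, h⟩) with h | h <;> simp [h]

theorem symbol_injective : Function.Injective (symbol (l := l)) := by
  intro f g h
  funext i
  have := congrFun h i
  rwa [symbol_val, symbol_val, Units.val_inj] at this

/-- The weight `∑ f_j e_j + 2 t δ` attached to a pair `(t, f)`. -/
def weight (p : ℤ × SignString l) (n : ℕ) : ℤ := if n = l then 2 * p.1 else symbol p.2 n

theorem weight_injective : Function.Injective (weight (l := l)) := by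
  intro p q h
  refine Prod.ext ?_ (symbol_injective (funext fun n => ?_))
  · have := congrFun h l
    simp only [weight, if_true] at this
    omega
  · by_cases hn : n = l
    · simp [symbol, hn]
    · simpa [weight, hn] using congrFun h n

/-- The operators on pairs describing the action of the generators of the affine Weyl group. -/
def pairStep (hl : 3 ≤ l) (i : Fin (l + 1)) (p : ℤ × SignString l) : ℤ × SignString l :=
  let a : Fin l := ⟨0, by omega⟩
  let b : Fin l := ⟨1, by omega⟩
  if (i : ℕ) = 0 then
    (p.1 + (p.2 a + p.2 b : ℤ) / 2, fun j => if j = a then -p.2 b else if j = b then -p.2 a else p.2 j)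
  else if h : (i : ℕ) = l then
    (p.1, Function.update p.2 ⟨l - 1, by omega⟩ (-p.2 ⟨l - 1, by omega⟩))
  else
    (p.1, p.2 ∘ Equiv.swap ⟨i - 1, by omega⟩ ⟨i, by omega⟩)

theorem symbol_pairStep (hl : 3 ≤ l) (i : Fin (l + 1)) (p : ℤ × SignString l) (n : ℕ) :
    symbol (pairStep hl i p).2 n =
      if (i : ℕ) = 0 then
        (if n = 0 then -symbol p.2 1 else if n = 1 then -symbol p.2 0 else symbol p.2 n)
      else if (i : ℕ) = l then (if n = l - 1 then -symbol p.2 n else symbol p.2 n)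
      else (if n = i - 1 then symbol p.2 i else if n = i then symbol p.2 (i - 1)
        else symbol p.2 n) := by
  obtain ⟨i, hi⟩ := i
  by_cases hn : n < l
  · rw [symbol_of_lt _ hn]
    by_cases h0 : i = 0
    · simp only [pairStep, h0, if_true, Fin.mk.injEq]
      rw [symbol_of_lt p.2 (show 1 < l by omega), symbol_of_lt p.2 (show 0 < l by omega),
        symbol_of_lt p.2 hn]
      split_ifs <;> simp
    · by_cases h1 : i = l
      · simp only [pairStep, dif_pos h1, if_neg h0, if_pos h1, symbol_of_lt p.2 hn,
          Function.update_apply, Fin.mk.injEq]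
        split_ifs with h
        · subst h
          simp
        · rfl
      · simp only [pairStep, dif_neg h1, if_neg h0, if_neg h1, Function.comp_apply,
          Equiv.swap_apply_def, Fin.mk.injEq]
        rw [symbol_of_lt p.2 hn, symbol_of_lt p.2 (show i < l by omega),
          symbol_of_lt p.2 (show i - 1 < l by omega)]
        split_ifs <;> rfl
  · have hs : ∀ g : SignString l, symbol g n = 0 := fun g => dif_neg hn
    simp only [hs]
    have : n ≠ 0 ∧ n ≠ 1 ∧ n ≠ l - 1 := by omega
    split_ifs <;> simp_all <;> omega

/-- Two signs have an even sum, so the integer division in `pairStep` is exact. -/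
theorem two_mul_pairStep_fst (hl : 3 ≤ l) (i : Fin (l + 1)) (p : ℤ × SignString l) :
    2 * (pairStep hl i p).1 =
      if (i : ℕ) = 0 then 2 * p.1 + symbol p.2 0 + symbol p.2 1 else 2 * p.1 := by
  have h0 := symbol_eq_or p.2 (show 0 < l by omega)
  have h1 := symbol_eq_or p.2 (show 1 < l by omega)
  unfold pairStep
  rw [symbol_of_lt _ (show 0 < l by omega)] at h0 ⊢
  rw [symbol_of_lt _ (show 1 < l by omega)] at h1 ⊢
  split_ifs
  · dsimp only
    omega
  · rfl
  · rfl

/-- The reflections permute the weights. In particular the one in `δ - e_0 - e_1` swaps and negates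
the first two coordinates and adds `f_0 + f_1` to the `δ`-coordinate `2t`; this is the reason for
the factor `2` in `weight`. -/
theorem weight_pairStep (hl : 3 ≤ l) (i : Fin (l + 1)) (p : ℤ × SignString l) :
    weight (pairStep hl i p) = (affineData l hl).reflection i (weight p) := by
  funext n
  rw [ReflectionData.reflection_apply]
  change _ = weight p n - affineCoroot l i (weight p) * affineRoot l i n
  obtain ⟨i, hi⟩ := i
  rw [affineCoroot_apply, affineRoot_apply]
  simp only [weight, two_mul_pairStep_fst, symbol_pairStep]
  have hz : symbol p.2 l = 0 := dif_neg (lt_irrefl l)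
  by_cases h0 : i = 0
  · subst h0
    grind
  · by_cases h1 : i = l
    · subst h1
      grind
    · grind

theorem pairStep_involutive (hl : 3 ≤ l) (i : Fin (l + 1)) :
    Function.Involutive (pairStep hl i) := by
  intro p
  apply weight_injective
  rw [weight_pairStep, weight_pairStep]
  have h := (affineData l hl).isLiftable i i
  rw [CoxeterMatrix.diagonal, pow_one] at h
  exact LinearMap.congr_fun h (weight p)

/-- The permutation of the set of pairs given by `pairStep`. -/
def pairPerm (hl : 3 ≤ l) (i : Fin (l + 1)) : Equiv.Perm (ℤ × SignString l) :=
  (pairStep_involutive hl i).toPerm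

theorem pairPerm_apply (hl : 3 ≤ l) (i : Fin (l + 1)) (p : ℤ × SignString l) :
    pairPerm hl i p = pairStep hl i p := rfl

/-- The relations hold for the reflections and descend along the injective equivariant map `weight`.
-/
theorem pairPerm_isLiftable (hl : 3 ≤ l) :
    (coxeterMatrix (cartanAffineB l)).IsLiftable (pairPerm hl) := by
  intro i j
  have key : ∀ (n : ℕ) (p : ℤ × SignString l), weight (((pairPerm hl i * pairPerm hl j) ^ n) p) =
      (((affineData l hl).reflection i * (affineData l hl).reflection j) ^ n) (weight p) := by
    intro n
    induction n with
    | zero => intro p; rfl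
    | succ n ih =>
      intro p
      rw [pow_succ, pow_succ, Equiv.Perm.mul_apply, ih, Equiv.Perm.mul_apply, pairPerm_apply,
        pairPerm_apply, weight_pairStep, weight_pairStep]
      rfl
  ext1 p
  apply weight_injective
  rw [key, (affineData l hl).isLiftable i j]
  rfl

/-- The action of the affine Weyl group on pairs. -/
noncomputable def pairAction (hl : 3 ≤ l) : AffineWeyl l →* Equiv.Perm (ℤ × SignString l) :=
  (coxeterMatrix (cartanAffineB l)).toCoxeterSystem.lift ⟨pairPerm hl, pairPerm_isLiftable hl⟩

theorem pairAction_s (hl : 3 ≤ l) (i : Fin (l + 1)) : pairAction hl (s i) = pairPerm hl i :=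
  (coxeterMatrix (cartanAffineB l)).toCoxeterSystem.lift_apply_simple (pairPerm_isLiftable hl) i

theorem pairAction_s_apply (hl : 3 ≤ l) (i : Fin (l + 1)) (p : ℤ × SignString l) :
    pairAction hl (s i) p = pairStep hl i p := by
  rw [pairAction_s, pairPerm_apply]

theorem weight_pairAction (hl : 3 ≤ l) (w : AffineWeyl l) (p : ℤ × SignString l) :
    weight (pairAction hl w p) = (affineData l hl).rep w (weight p) := by
  induction w using (coxeterMatrix (cartanAffineB l)).toCoxeterSystem.simple_induction_left
    generalizing p with
  | one => simp
  | mul_simple_left w i ih =>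
    rw [map_mul, map_mul, Equiv.Perm.mul_apply, Module.End.mul_apply, ← ih,
      ReflectionData.rep_simple, ← weight_pairStep]
    exact congrArg weight (pairAction_s_apply hl i _)

/-- An element acting trivially fixes the weights of both `p` and `s_i p`, hence their difference, a
multiple of `α_i`. If that multiple is nonzero, it fixes `α_i` itself. -/
theorem pairAction_injective (hl : 3 ≤ l) : Function.Injective (pairAction hl) := by
  rw [injective_iff_map_eq_one]
  intro w hw
  apply (affineData l hl).eq_one_of_rep_root_eq
  intro i
  have hfix : ∀ p : ℤ × SignString l, (affineData l hl).rep w (weight p) = weight p := by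
    intro p
    rw [← weight_pairAction, hw]
    rfl
  obtain ⟨p, hp⟩ : ∃ p : ℤ × SignString l, (affineData l hl).coroot i (weight p) ≠ 0 := by
    obtain ⟨i, hi⟩ := i
    -- A sign change between positions `i - 1` and `i` makes the pairing `2` when `0 < i < l`. For
    -- `i = 0` and `i = l` the string is constantly `+`, with pairings `-2` and `2`.
    let f : SignString l := fun j => if i ≠ 0 ∧ (j : ℕ) = i then -1 else 1
    have hf : ∀ n < l, symbol f n = if i ≠ 0 ∧ n = i then -1 else 1 := by
      intro n hn
      rw [symbol_of_lt f hn]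
      dsimp only [f]
      split_ifs <;> rfl
    refine ⟨(0, f), ?_⟩
    change affineCoroot l i _ ≠ 0
    rw [affineCoroot_apply]
    simp only [weight]
    have h0 := hf 0 (by omega)
    have h1 := hf 1 (by omega)
    have h2 := hf (l - 1) (by omega)
    grind
  have h1 := hfix (pairStep hl i p)
  rw [weight_pairStep, ReflectionData.reflection_apply, map_sub, map_smul, hfix] at h1
  exact smul_right_injective _ hp (sub_right_injective h1)

theorem pairAction_finite (hl : 3 ≤ l) {w : AffineWeyl l} (hw : w ∈ finiteWeyl l) (t : ℤ)
    (f : SignString l) : pairAction hl w (t, f) = (t, (pairAction hl w (0, f)).2) := by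
  induction hw using Subgroup.closure_induction generalizing t f with
  | mem x hx =>
    obtain ⟨i, rfl⟩ := hx
    simp only [pairAction_s_apply]
    unfold pairStep
    simp only [Fin.val_succ, Nat.add_eq_zero_iff, one_ne_zero, and_false, if_false]
    split_ifs <;> rfl
  | one => rfl
  | mul x y _ _ hx hy =>
    rw [map_mul, Equiv.Perm.mul_apply, Equiv.Perm.mul_apply, hy t, hy 0, hx]
  | inv x _ hx =>
    rw [map_inv]
    obtain ⟨⟨t', f'⟩, h⟩ := (pairAction hl x).surjective (t, f)
    have h' := h
    rw [hx, Prod.mk.injEq] at h'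
    obtain ⟨rfl, h'⟩ := h'
    have h0 : pairAction hl x (0, f') = (0, f) := by rw [hx, h']
    have hinv : ∀ p, (pairAction hl x)⁻¹ (pairAction hl x p) = p :=
      (pairAction hl x).symm_apply_apply
    rw [← h, hinv, ← h0, hinv]

end PairAction

/-! ### The spin heap is a full heap -/

namespace SpinHeap

variable {l : ℕ}

theorem le_iff (a b : SpinHeap l) :
    a ≤ b ↔ (a.x : ℤ) - (b.x : ℤ) ≤ b.y - a.y ∧ (b.x : ℤ) - (a.x : ℤ) ≤ b.y - a.y := by
  change |(a.x : ℤ) - (b.x : ℤ)| ≤ b.y - a.y ↔ _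
  rw [abs_le]
  omega

theorem lt_iff (a b : SpinHeap l) : a < b ↔ a ≤ b ∧ a.y < b.y := by
  rw [lt_iff_le_not_ge, le_iff, le_iff]
  omega

theorem eq_iff (a b : SpinHeap l) : a = b ↔ (a.x : ℕ) = b.x ∧ a.y = b.y := by
  rw [SpinHeap.ext_iff, Fin.ext_iff]

theorem parity (a : SpinHeap l) : ((a.x : ℤ) - a.y) % 2 = 0 := Int.even_iff.1 a.even_sub

/-- The point of the spin heap with given coordinates. -/
def point (x : ℕ) (y : ℤ) (hx : x < l) (h : ((x : ℤ) - y) % 2 = 0) : SpinHeap l :=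
  ⟨⟨x, hx⟩, y, Int.even_iff.2 h⟩

@[simp]
theorem point_x (x : ℕ) (y : ℤ) (hx : x < l) (h : ((x : ℤ) - y) % 2 = 0) :
    ((point x y hx h).x : ℕ) = x := rfl

@[simp]
theorem point_y (x : ℕ) (y : ℤ) (hx : x < l) (h : ((x : ℤ) - y) % 2 = 0) :
    (point x y hx h).y = y := rfl

theorem label_val (a : SpinHeap l) :
    (label a : ℕ) = if (a.x : ℕ) = 0 ∧ ¬ (4 : ℤ) ∣ a.y then 0 else (a.x : ℕ) + 1 := by
  unfold label
  split_ifs <;> rfl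

theorem label_cases (a : SpinHeap l) : ((label a : ℕ) = 0 ∧ (a.x : ℕ) = 0 ∧ a.y % 4 ≠ 0) ∨
    ((label a : ℕ) = (a.x : ℕ) + 1 ∧ ((a.x : ℕ) ≠ 0 ∨ a.y % 4 = 0)) := by
  have h := Int.dvd_iff_emod_eq_zero (a := 4) (b := a.y)
  rw [label_val]
  by_cases h4 : a.y % 4 = 0 <;> simp only [h, h4, not_true, not_false_iff] <;> grind

theorem label_eq_iff (a : SpinHeap l) (p : Fin (l + 1)) : label a = p ↔
    ((p : ℕ) = 0 ∧ (a.x : ℕ) = 0 ∧ a.y % 4 ≠ 0) ∨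
    ((p : ℕ) = (a.x : ℕ) + 1 ∧ ((a.x : ℕ) ≠ 0 ∨ a.y % 4 = 0)) := by
  have := label_cases a
  rw [Fin.ext_iff]
  omega

theorem cartanAffineB_apply (i j : Fin (l + 1)) : cartanAffineB l i j =
    if (i : ℕ) = j then 2
    else if (i : ℕ) = l ∧ (j : ℕ) + 1 = l then -2
    else if ((i : ℕ) = 0 ∧ (j : ℕ) = 2) ∨ ((i : ℕ) = 2 ∧ (j : ℕ) = 0) then -1
    else if (0 < (i : ℕ) ∧ (i : ℕ) + 1 = j) ∨ (0 < (j : ℕ) ∧ (j : ℕ) + 1 = i) then -1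
    else 0 := by
  simp only [cartanAffineB, Matrix.of_apply, Fin.ext_iff]

theorem adjacent_iff (hl : 3 ≤ l) (i j : Fin (l + 1)) : Adjacent (cartanAffineB l) i j ↔
    ((i : ℕ) = 0 ∧ (j : ℕ) = 2) ∨ ((i : ℕ) = 2 ∧ (j : ℕ) = 0) ∨
      (0 < (i : ℕ) ∧ (i : ℕ) + 1 = j) ∨ (0 < (j : ℕ) ∧ (j : ℕ) + 1 = i) := by
  unfold Adjacent
  rw [cartanAffineB_apply, ne_eq, Fin.ext_iff]
  grind

theorem concurrent_of_column (hl : 3 ≤ l) (a b : SpinHeap l)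
    (h : (a.x : ℕ) + 1 = b.x ∨ (b.x : ℕ) + 1 = a.x) :
    Concurrent (cartanAffineB l) (label a) (label b) := by
  right
  have ha := label_cases a
  have hb := label_cases b
  rw [adjacent_iff hl]
  omega

/-- There is no full converse: the labels `0` and `1` share column `0` but are neither equal nor
adjacent. -/
theorem column_of_concurrent (hl : 3 ≤ l) (a b : SpinHeap l)
    (h : Concurrent (cartanAffineB l) (label a) (label b)) :
    (a.x : ℕ) = b.x ∨ (a.x : ℕ) + 1 = b.x ∨ (b.x : ℕ) + 1 = a.x := by
  unfold Concurrent at h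
  have ha := label_cases a
  have hb := label_cases b
  rw [adjacent_iff hl, Fin.ext_iff] at h
  omega

/-- The coordinate `y` increases strictly along the order, so nothing fits into a gap of `1`. -/
theorem covBy_of_column (a b : SpinHeap l)
    (h : (a.x : ℕ) + 1 = b.x ∨ (b.x : ℕ) + 1 = a.x) (hy : b.y = a.y + 1) : a ⋖ b := by
  refine ⟨?_, fun c hac hcb => ?_⟩
  · rw [lt_iff, le_iff]
    omega
  · rw [lt_iff] at hac hcb
    omega

/-- Every interval `a < b` of the spin heap contains an upper cover of `a`. -/
theorem exists_step (hl : 3 ≤ l) {a b : SpinHeap l} (hab : a < b) :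
    ∃ c : SpinHeap l, c.y = a.y + 1 ∧ ((a.x : ℕ) + 1 = c.x ∨ (c.x : ℕ) + 1 = a.x) ∧ c ≤ b := by
  rw [lt_iff, le_iff] at hab
  have ha := a.parity
  have hb := b.parity
  have hax := a.x.2
  have hbx := b.x.2
  -- The step goes towards the column of `b`. If the columns agree, parity makes the height
  -- difference at least `2`, so a sideways step in either direction stays below `b`.
  by_cases h : (a.x : ℕ) < b.x ∨ (a.x : ℕ) = 0
  · refine ⟨point (a.x + 1) (a.y + 1) (by omega) (by omega), rfl, Or.inl rfl, ?_⟩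
    rw [le_iff]
    simp only [point_x, point_y]
    omega
  · refine ⟨point (a.x - 1) (a.y + 1) (by omega) (by omega), rfl, Or.inr ?_, ?_⟩
    · simp only [point_x]
      omega
    · rw [le_iff]
      simp only [point_x, point_y]
      omega

theorem isLabelledHeap (hl : 3 ≤ l) : IsLabelledHeap (cartanAffineB l) (label (l := l)) where
  locallyFinite a b := by
    refine Set.Finite.of_finite_image (f := fun c : SpinHeap l => (c.x, c.y)) ?_ ?_
    · refine (Set.toFinite ((Set.univ : Set (Fin l)) ×ˢ Set.Icc a.y b.y)).subset ?_
      rintro _ ⟨c, ⟨h1, h2⟩, rfl⟩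
      rw [le_iff] at h1 h2
      simp only [Set.mem_prod, Set.mem_univ, Set.mem_Icc, true_and]
      omega
    · intro c _ d _ h
      simp only [Prod.mk.injEq] at h
      exact SpinHeap.ext h.1 h.2
  comparable a b h := by
    -- Points in adjacent columns have heights of different parity, so their height difference is at
    -- least the column distance `1`.
    have := column_of_concurrent hl a b h
    have ha := a.parity
    have hla := label_cases a
    have hb := b.parity
    rw [le_iff, le_iff]
    omega
  generated a b := by
    constructor
    · intro h
      obtain ⟨n, hn⟩ : ∃ n : ℕ, b.y - a.y = n := by
        rw [le_iff] at h
        exact ⟨(b.y - a.y).toNat, by omega⟩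
      induction n generalizing a with
      | zero =>
        have : a = b := by
          by_contra hne
          have := (lt_iff a b).1 (lt_of_le_of_ne h hne)
          omega
        subst this
        exact Relation.TransGen.single ⟨le_rfl, Or.inl rfl⟩
      | succ n ih =>
        obtain ⟨c, hcy, hcx, hcb⟩ := exists_step hl ((lt_iff a b).2 ⟨h, by omega⟩)
        exact Relation.TransGen.head
          ⟨(covBy_of_column a c hcx hcy).le, concurrent_of_column hl a c hcx⟩
          (ih c hcb (by omega))
    · intro h
      induction h with
      | single h => exact h.1
      | tail _ h ih => exact ih.trans h.1

theorem isFibred (hl : 3 ≤ l) : IsFibred (cartanAffineB l) (label (l := l)) where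
  toIsLabelledHeap := isLabelledHeap hl
  nonempty p := by
    obtain ⟨p, hp⟩ := p
    rcases Nat.eq_zero_or_pos p with rfl | h
    · refine ⟨point 0 2 (by omega) (by norm_num), ?_⟩
      rw [label_eq_iff]
      norm_num
    · by_cases h1 : p = 1
      · refine ⟨point 0 0 (by omega) (by norm_num), ?_⟩
        rw [label_eq_iff]
        simp [h1]
      · refine ⟨point (p - 1) (p - 1 : ℕ) (by omega) (by omega), ?_⟩
        rw [label_eq_iff]
        simp only [point_x, point_y]
        omega
  unbounded_above a := by
    have ha := a.parity
    have hla := label_cases a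
    refine ⟨point a.x (a.y + 4) a.x.2 (by omega), ?_, ?_⟩
    · rw [label_eq_iff]
      simp only [point_x, point_y]
      omega
    · rw [lt_iff, le_iff]
      simp only [point_x, point_y]
      omega
  unbounded_below a := by
    have ha := a.parity
    have hla := label_cases a
    refine ⟨point a.x (a.y - 4) a.x.2 (by omega), ?_, ?_⟩
    · rw [label_eq_iff]
      simp only [point_x, point_y]
      omega
    · rw [lt_iff, le_iff]
      simp only [point_x, point_y]
      omega
  exists_cover a q h := by
    rw [adjacent_iff hl] at h
    have ha := a.parity
    have hla := label_cases a
    have hax := a.x.2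
    have hq := q.2
    by_cases h1 : (q : ℕ) ≤ 1
    · have hx : (a.x : ℕ) = 1 := by omega
      -- The labels `0` and `1` alternate in column `0`, so exactly one of its points at heights
      -- `a.y ± 1` carries the label `q`.
      by_cases h2 : ((a.y + 1) % 4 = 0 ∧ (q : ℕ) = 1) ∨ ((a.y + 1) % 4 ≠ 0 ∧ (q : ℕ) = 0)
      · refine ⟨point 0 (a.y + 1) (by omega) (by omega), ?_, Or.inr ?_⟩
        · rw [label_eq_iff]
          simp only [point_x, point_y, true_and]
          omega
        · exact covBy_of_column _ _ (Or.inr hx.symm) rfl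
      · refine ⟨point 0 (a.y - 1) (by omega) (by omega), ?_, Or.inl ?_⟩
        · rw [label_eq_iff]
          simp only [point_x, point_y, true_and]
          omega
        · exact covBy_of_column _ _ (Or.inl hx.symm) (by simp)
    · have hx : (a.x : ℕ) + 1 = (q : ℕ) - 1 ∨ (q : ℕ) - 1 + 1 = a.x := by omega
      refine ⟨point (q - 1) (a.y + 1) (by omega) (by omega), ?_, Or.inr ?_⟩
      · rw [label_eq_iff]
        simp only [point_x, point_y]
        omega
      · exact covBy_of_column _ _ hx rfl

/-- In column `0` equal labels recur after `4` steps, and the interval has labels `2`, `2`, `3` and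
the other one of `0`, `1`; only the two `2`s contribute, `-1` each. In column `x ≥ 1` they recur
after `2` steps, and the interval consists of the neighbours at height `a.y + 1`: two entries `-1`,
or in the last column one entry `-2`. -/
theorem isFull (hl : 3 ≤ l) : IsFull (cartanAffineB l) (label (l := l)) where
  toIsFibred := isFibred hl
  sum_eq a b hab h hc := by
    classical
    rw [lt_iff, le_iff] at hab
    have ha := a.parity
    have hla := label_cases a
    have hb := b.parity
    have hlb := label_cases b
    have hax := a.x.2
    have hx : (a.x : ℕ) = b.x := by
      rw [Fin.ext_iff] at h
      omega
    have no_between : ∀ (y : ℤ) (hy : ((a.x : ℤ) - y) % 2 = 0), a.y < y → y < b.y →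
        label (point a.x y a.x.2 hy) ≠ label a := by
      intro y hy h1 h2
      apply hc
      simp only [Set.mem_Ioo, lt_iff, le_iff, point_x, point_y]
      omega
    by_cases h0 : (a.x : ℕ) = 0
    · have hby : b.y = a.y + 4 := by
        have h4 : ¬ a.y + 4 < b.y := by
          intro h4
          refine no_between (a.y + 4) (by omega) (by omega) h4 ?_
          rw [label_eq_iff]
          simp only [point_x, point_y]
          omega
        rw [Fin.ext_iff] at h
        omega
      let c1 : SpinHeap l := point 1 (a.y + 1) (by omega) (by omega)
      let c2 : SpinHeap l := point 0 (a.y + 2) (by omega) (by omega)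
      let c3 : SpinHeap l := point 2 (a.y + 2) (by omega) (by omega)
      let c4 : SpinHeap l := point 1 (a.y + 3) (by omega) (by omega)
      have hIoo : Set.Ioo a b = (({c1, c2, c3, c4} : Finset (SpinHeap l)) : Set (SpinHeap l)) := by
        ext c
        have hcp := c.parity
        simp only [Set.mem_Ioo, lt_iff, le_iff, Finset.coe_insert, Finset.coe_singleton,
          Set.mem_insert_iff, Set.mem_singleton_iff, eq_iff, c1, c2, c3, c4, point_x, point_y]
        omega
      rw [hIoo, finsum_mem_coe_finset, Finset.sum_insert, Finset.sum_insert, Finset.sum_insert,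
        Finset.sum_singleton]
      · have h1 := label_cases c1
        have h2 := label_cases c2
        have h3 := label_cases c3
        have h4 := label_cases c4
        have hx1 : (c1.x : ℕ) = 1 ∧ c1.y = a.y + 1 := ⟨rfl, rfl⟩
        have hx2 : (c2.x : ℕ) = 0 ∧ c2.y = a.y + 2 := ⟨rfl, rfl⟩
        have hx3 : (c3.x : ℕ) = 2 ∧ c3.y = a.y + 2 := ⟨rfl, rfl⟩
        have hx4 : (c4.x : ℕ) = 1 ∧ c4.y = a.y + 3 := ⟨rfl, rfl⟩
        have e1 : (label c1 : ℕ) = 2 := by omega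
        have e3 : (label c3 : ℕ) = 3 := by omega
        have e4 : (label c4 : ℕ) = 2 := by omega
        have e2 : ((label a : ℕ) = 0 ∧ (label c2 : ℕ) = 1) ∨
            ((label a : ℕ) = 1 ∧ (label c2 : ℕ) = 0) := by omega
        simp only [cartanAffineB_apply, e1, e3, e4]
        clear_value c1 c2 c3 c4
        clear no_between hc hIoo h1 h2 h3 h4
        rcases e2 with ⟨e, e2⟩ | ⟨e, e2⟩ <;> rw [e, e2] <;> grind
      all_goals
        simp only [Finset.mem_insert, Finset.mem_singleton, eq_iff, c1, c2, c3, c4,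
          point_x, point_y]
        omega
    · have hby : b.y = a.y + 2 := by
        by_contra h2
        refine no_between (a.y + 2) (by omega) (by omega) (by omega) ?_
        rw [label_eq_iff]
        simp only [point_x, point_y]
        omega
      let c1 : SpinHeap l := point (a.x - 1) (a.y + 1) (by omega) (by omega)
      by_cases h1 : (a.x : ℕ) + 1 = l
      · have hIoo : Set.Ioo a b = (({c1} : Finset (SpinHeap l)) : Set (SpinHeap l)) := by
          ext c
          have hcp := c.parity
          have hcx := c.x.2
          simp only [Set.mem_Ioo, lt_iff, le_iff, Finset.coe_singleton,
            Set.mem_singleton_iff, eq_iff, c1, point_x, point_y]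
          omega
        rw [hIoo, finsum_mem_coe_finset, Finset.sum_singleton]
        have h3 := label_cases c1
        simp only [c1, point_x, point_y] at h3
        simp only [cartanAffineB_apply, c1]
        grind
      · let c2 : SpinHeap l := point (a.x + 1) (a.y + 1) (by omega) (by omega)
        have hIoo : Set.Ioo a b = (({c1, c2} : Finset (SpinHeap l)) : Set (SpinHeap l)) := by
          ext c
          have hcp := c.parity
          have hcx := c.x.2
          simp only [Set.mem_Ioo, lt_iff, le_iff, Finset.coe_insert, Finset.coe_singleton,
            Set.mem_insert_iff, Set.mem_singleton_iff, eq_iff, c1, c2, point_x, point_y]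
          omega
        rw [hIoo, finsum_mem_coe_finset, Finset.sum_insert, Finset.sum_singleton]
        · have h3 := label_cases c1
          have h4 := label_cases c2
          simp only [c1, c2, point_x, point_y] at h3 h4
          simp only [cartanAffineB_apply, c1, c2]
          grind
        · simp only [Finset.mem_singleton, eq_iff, c1, c2, point_x, point_y]
          omega

end SpinHeap

open SpinHeap

/-! ### Proper ideals of the spin heap and their profiles -/

section Profile

variable {l : ℕ}

/-- The heights of the topmost elements of the columns of the proper ideal with coordinates
`p`. -/
def profile (p : ℤ × SignString l) (n : ℕ) : ℤ :=
  4 * p.1 - 1 + ∑ j ∈ Finset.range (n + 1), symbol p.2 j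

theorem profile_zero (p : ℤ × SignString l) : profile p 0 = 4 * p.1 - 1 + symbol p.2 0 := by
  simp [profile]

theorem profile_succ (p : ℤ × SignString l) (n : ℕ) :
    profile p (n + 1) = profile p n + symbol p.2 (n + 1) := by
  simp only [profile]
  rw [Finset.sum_range_succ _ (n + 1)]
  ring

theorem profile_parity (p : ℤ × SignString l) {n : ℕ} (hn : n < l) :
    ((n : ℤ) - profile p n) % 2 = 0 := by
  induction n with
  | zero =>
    have := symbol_eq_or p.2 hn
    rw [profile_zero]
    omega
  | succ n ih =>
    have := symbol_eq_or p.2 hn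
    have := ih (by omega)
    rw [profile_succ]
    omega

theorem profile_lipschitz (p : ℤ × SignString l) (n k : ℕ) :
    profile p (n + k) ≤ profile p n + k ∧ profile p n ≤ profile p (n + k) + k := by
  induction k with
  | zero => simp
  | succ k ih =>
    have hs : -1 ≤ symbol p.2 (n + k + 1) ∧ symbol p.2 (n + k + 1) ≤ 1 := by
      by_cases h : n + k + 1 < l
      · rcases symbol_eq_or p.2 h with h | h <;> omega
      · simp [symbol, h]
    rw [← add_assoc, profile_succ]
    omega

/-- The proper ideal with coordinates `p`. -/
def profileIdeal (p : ℤ × SignString l) : Set (SpinHeap l) := {a | a.y ≤ profile p a.x}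

theorem mem_profileIdeal (p : ℤ × SignString l) (a : SpinHeap l) :
    a ∈ profileIdeal p ↔ a.y ≤ profile p a.x := Iff.rfl

theorem isLowerSet_profileIdeal (p : ℤ × SignString l) : IsLowerSet (profileIdeal p) := by
  intro a b hba ha
  rw [mem_profileIdeal] at *
  rw [le_iff] at hba
  rcases le_total (a.x : ℕ) b.x with h | h
  · obtain ⟨k, hk⟩ := Nat.exists_eq_add_of_le h
    have := profile_lipschitz p a.x k
    rw [← hk] at this
    omega
  · obtain ⟨k, hk⟩ := Nat.exists_eq_add_of_le h
    have := profile_lipschitz p b.x k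
    rw [← hk] at this
    omega

theorem SpinHeap.label_shift (k : ℤ) (a : SpinHeap l) : label (shift k a) = label a := by
  have h := label_cases a
  have hx : ((shift k a).x : ℕ) = a.x := rfl
  have hy : (shift k a).y = a.y + 4 * k := rfl
  rw [label_eq_iff]
  omega

theorem isProperIdeal_profileIdeal (hl : 3 ≤ l) (p : ℤ × SignString l) :
    IsProperIdeal (label (l := l)) (profileIdeal p) := by
  have hmem : ∀ q, ∃ a : SpinHeap l, label a = q ∧ a ∈ profileIdeal p := by
    intro q
    obtain ⟨a, ha⟩ := (isFibred hl).nonempty q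
    -- Shifts by multiples of `4` preserve labels, so each label occurs below the profile and, one
    -- period higher, above it.
    refine ⟨shift ((profile p a.x - a.y) / 4) a, by rw [label_shift, ha], ?_⟩
    change a.y + 4 * ((profile p a.x - a.y) / 4) ≤ profile p a.x
    omega
  have hnot : ∀ q, ∃ a : SpinHeap l, label a = q ∧ a ∉ profileIdeal p := by
    intro q
    obtain ⟨a, ha⟩ := (isFibred hl).nonempty q
    refine ⟨shift ((profile p a.x - a.y) / 4 + 1) a, by rw [label_shift, ha], ?_⟩
    change ¬ a.y + 4 * ((profile p a.x - a.y) / 4 + 1) ≤ profile p a.x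
    omega
  refine ⟨isLowerSet_profileIdeal p, ?_, ?_, ?_, ?_⟩
  · obtain ⟨a, -, ha⟩ := hmem 0
    exact ⟨a, ha⟩
  · obtain ⟨a, -, ha⟩ := hnot 0
    intro h
    rw [h] at ha
    exact ha (Set.mem_univ a)
  · intro q
    obtain ⟨a, hq, ha⟩ := hmem q
    exact ⟨a, ha, hq⟩
  · intro q
    refine ⟨Set.inter_subset_right, fun h => ?_⟩
    obtain ⟨a, hq, ha⟩ := hnot q
    exact ha (h (a := a) hq).1

/-! ### Every proper ideal comes from a lattice path -/

theorem exists_column_top {F : Set (SpinHeap l)} (hF : IsProperIdeal (label (l := l)) F)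
    (x : Fin l) : ∃ g : ℤ, ((x : ℤ) - g) % 2 = 0 ∧ ∀ a : SpinHeap l, a.x = x → (a ∈ F ↔ a.y ≤ g) := by
  -- The label `x + 1` occurs only in column `x`. Properness at this one label makes the part of `F`
  -- in the column nonempty and bounded above.
  obtain ⟨a, haF, ha⟩ := hF.inter_nonempty x.succ
  obtain ⟨b, hb, hbF⟩ := Set.exists_of_ssubset (hF.inter_ssubset x.succ)
  replace hbF : b ∉ F := fun h => hbF ⟨h, hb⟩
  have column : ∀ c : SpinHeap l, label c = x.succ → c.x = x := by
    intro c hc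
    rw [label_eq_iff, Fin.val_succ] at hc
    rw [Fin.ext_iff]
    omega
  have hax := column a ha
  have hbx := column b hb
  have hmono : ∀ c d : SpinHeap l, c.x = x → d.x = x → c.y ≤ d.y → d ∈ F → c ∈ F := by
    intro c d hc hd h hdF
    refine hF.isLowerSet ?_ hdF
    rw [le_iff, hc, hd]
    omega
  obtain ⟨g, ⟨c, hcF, hcx, rfl⟩, hg⟩ :=
    Int.exists_greatest_of_bdd (P := fun y => ∃ c ∈ F, c.x = x ∧ c.y = y)
      ⟨b.y, by
        rintro y ⟨c, hcF, hcx, rfl⟩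
        by_contra h
        exact hbF (hmono b c hbx hcx (by omega) hcF)⟩
      ⟨a.y, a, haF, hax, rfl⟩
  refine ⟨c.y, by rw [← hcx]; exact c.parity, fun d hd => ⟨fun h => hg _ ⟨d, h, hd, rfl⟩, fun h => ?_⟩⟩
  exact hmono d c hd hcx h hcF

theorem exists_eq_profileIdeal {F : Set (SpinHeap l)}
    (hF : IsProperIdeal (label (l := l)) F) : ∃ p : ℤ × SignString l, F = profileIdeal p := by
  have h : ∀ n : ℕ, ∃ g : ℤ, n < l → ((n : ℤ) - g) % 2 = 0 ∧
      ∀ a : SpinHeap l, (a.x : ℕ) = n → (a ∈ F ↔ a.y ≤ g) := by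
    intro n
    by_cases hn : n < l
    · obtain ⟨g, hg, hg'⟩ := exists_column_top hF ⟨n, hn⟩
      exact ⟨g, fun _ => ⟨hg, fun a ha => hg' a (Fin.ext ha)⟩⟩
    · exact ⟨0, fun h => absurd h hn⟩
  choose g hg using h
  -- The point one below a column top in a neighbouring column lies in `F`, so tops differ by at
  -- most `1`, and by parity they differ.
  have hstep : ∀ n, n + 1 < l → g (n + 1) = g n + 1 ∨ g (n + 1) = g n - 1 := by
    intro n hn
    obtain ⟨h1, h1'⟩ := hg n (by omega)
    obtain ⟨h2, h2'⟩ := hg (n + 1) hn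
    have h3 : g n - 1 ≤ g (n + 1) := by
      refine (h2' (point (n + 1) (g n - 1) hn (by omega)) rfl).1 ?_
      refine hF.isLowerSet (a := point n (g n) (by omega) h1) ?_ ((h1' _ rfl).2 le_rfl)
      simp [le_iff]
    have h4 : g (n + 1) - 1 ≤ g n := by
      refine (h1' (point n (g (n + 1) - 1) (by omega) (by omega)) rfl).1 ?_
      refine hF.isLowerSet (a := point (n + 1) (g (n + 1)) hn h2) ?_ ((h2' _ rfl).2 le_rfl)
      simp [le_iff]
    omega
  let f : SignString l := fun i =>
    if (i : ℕ) = 0 then (if g 0 % 4 = 0 then 1 else -1)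
    else if g (i - 1) < g i then 1 else -1
  have hf : ∀ n < l, symbol f n = if n = 0 then (if g 0 % 4 = 0 then 1 else -1)
      else if g (n - 1) < g n then 1 else -1 := by
    intro n hn
    rw [symbol_of_lt f hn]
    dsimp only [f]
    split_ifs <;> rfl
  -- The top of column `0` is `4t` or `4t - 2` according to the first sign; in both cases `(g 0 + 2)
  -- / 4 = t`.
  have hprof : ∀ n < l, profile ((g 0 + 2) / 4, f) n = g n := by
    intro n hn
    induction n with
    | zero =>
      have h0 := (hg 0 hn).1
      rw [profile_zero, hf 0 hn]
      dsimp only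
      split_ifs <;> omega
    | succ n ih =>
      have := hstep n hn
      rw [profile_succ, ih (by omega), hf _ hn]
      simp only [Nat.add_eq_zero_iff, one_ne_zero, and_false, if_false, Nat.add_sub_cancel]
      split_ifs <;> omega
  refine ⟨((g 0 + 2) / 4, f), ?_⟩
  ext a
  rw [mem_profileIdeal, hprof _ a.x.2]
  exact (hg a.x a.x.2).2 a rfl

/-! ### Recovering the height and the string from a lattice path -/

theorem height_profileIdeal (hl : 3 ≤ l) (p : ℤ × SignString l) :
    height (profileIdeal p) = p.1 := by
  have h0 := symbol_eq_or p.2 (show 0 < l by omega)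
  have : {t : ℤ | ∃ a ∈ profileIdeal p, a.IsZero t} = Set.Iic p.1 := by
    ext t
    simp only [Set.mem_ofPred_eq, Set.mem_Iic]
    constructor
    · rintro ⟨a, ha, hx, hy⟩
      rw [mem_profileIdeal, hx, profile_zero] at ha
      omega
    · intro ht
      refine ⟨point 0 (4 * t - 2) (by omega) (by omega), ?_, rfl, rfl⟩
      rw [mem_profileIdeal, point_x, point_y, profile_zero]
      omega
  rw [height, this, csSup_Iic]

theorem shift_image_profileIdeal (k t : ℤ) (f : SignString l) :
    shift k '' profileIdeal (t, f) = profileIdeal (t + k, f) := by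
  ext a
  constructor
  · rintro ⟨b, hb, rfl⟩
    rw [mem_profileIdeal] at hb ⊢
    change b.y + 4 * k ≤ profile (t + k, f) b.x
    simp only [profile] at hb ⊢
    linarith
  · intro ha
    refine ⟨shift (-k) a, ?_, ?_⟩
    · rw [mem_profileIdeal] at ha ⊢
      change a.y + 4 * (-k) ≤ profile (t, f) a.x
      simp only [profile] at ha ⊢
      linarith
    · apply SpinHeap.ext
      · rfl
      · change a.y + 4 * (-k) + 4 * k = a.y
        ring

theorem mem_baseIdeal (hl : 3 ≤ l) (a : SpinHeap l) :
    a ∈ baseIdeal ↔ (a.x : ℤ) ≤ -2 - a.y := by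
  constructor
  · rintro ⟨b, ⟨hx, hy⟩, h⟩
    rw [le_iff] at h
    omega
  · intro h
    refine ⟨point 0 (4 * 0 - 2) (by omega) (by omega), ⟨rfl, rfl⟩, ?_⟩
    rw [le_iff]
    simp only [point_x, point_y]
    omega

/-- The default `-i - 1` in `top` is the right one: column `i` of the difference is empty only if
the path has descended at every step, and then its top there is `-i - 2`, that of `baseIdeal`. -/
theorem top_profileIdeal (hl : 3 ≤ l) (f : SignString l) (i : Fin l) :
    top (profileIdeal (0, f) \ baseIdeal) i = profile (0, f) i + 1 := by
  have h0 := symbol_eq_or f (show 0 < l by omega)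
  have hz := profile_zero (0, f)
  have hlip := (profile_lipschitz (0, f) 0 i).2
  have hpar := profile_parity (0, f) i.2
  rw [zero_add] at hlip
  unfold top
  split_ifs with h
  · congr 1
    refine IsGreatest.csSup_eq ⟨?_, ?_⟩
    · obtain ⟨y, a, ⟨ha, ha'⟩, rfl, rfl⟩ := h
      refine ⟨point a.x (profile (0, f) a.x) a.x.2 hpar, ⟨?_, ?_⟩, rfl, rfl⟩
      · rw [mem_profileIdeal, point_x, point_y]
      · rw [mem_baseIdeal hl] at ha' ⊢
        rw [mem_profileIdeal] at ha
        rw [point_x, point_y]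
        omega
    · rintro y ⟨a, ⟨ha, -⟩, rfl, rfl⟩
      exact ha
  · have : ¬ -2 - (i : ℤ) < profile (0, f) i := by
      intro hlt
      refine h ⟨_, point i (profile (0, f) i) i.2 hpar, ⟨?_, ?_⟩, rfl, rfl⟩
      · rw [mem_profileIdeal, point_x, point_y]
      · rw [mem_baseIdeal hl, point_x, point_y]
        omega
    dsimp only at hz
    omega

/-- The binary path is the profile raised by `1`, and `f(-1) = 0` matches the virtual start `-1`;
its increments are therefore the symbols. -/
theorem stringOf_profileIdeal (hl : 3 ≤ l) (f : SignString l) :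
    stringOf (profileIdeal (0, f)) = f := by
  apply symbol_injective
  funext n
  by_cases hn : n < l
  swap
  · simp [symbol, hn]
  rw [symbol_of_lt _ hn]
  have hs := symbol_eq_or f hn
  have h1 : path (profileIdeal (0, f) \ baseIdeal) (Fin.succ ⟨n, hn⟩) = profile (0, f) n + 1 := by
    unfold path
    rw [Fin.cons_succ, top_profileIdeal hl]
  unfold stringOf signs
  rw [h1]
  cases n with
  | zero =>
    have h2 : path (profileIdeal (0, f) \ baseIdeal) (Fin.castSucc ⟨0, hn⟩) = 0 := rfl
    rw [h2, profile_zero]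
    dsimp only
    split_ifs <;> simp only [Units.val_one, Units.val_neg] <;> omega
  | succ n =>
    have h2 : path (profileIdeal (0, f) \ baseIdeal) (Fin.castSucc ⟨n + 1, hn⟩) =
        profile (0, f) n + 1 :=
      top_profileIdeal hl f ⟨n, by omega⟩
    rw [h2, profile_succ]
    dsimp only
    split_ifs <;> simp only [Units.val_one, Units.val_neg] <;> omega

theorem coords_of_eq (hl : 3 ≤ l) (I : Ideals l) (p : ℤ × SignString l)
    (h : I.1 = profileIdeal p) : coords I = p := by
  obtain ⟨t, f⟩ := p
  unfold coords
  rw [h, height_profileIdeal hl, shift_image_profileIdeal]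
  dsimp only
  rw [add_neg_cancel, stringOf_profileIdeal hl]

theorem eq_profileIdeal_coords (hl : 3 ≤ l) (I : Ideals l) : I.1 = profileIdeal (coords I) := by
  obtain ⟨p, hp⟩ := exists_eq_profileIdeal I.2
  rw [coords_of_eq hl I p hp, hp]

theorem coords_bijective (hl : 3 ≤ l) : Function.Bijective (coords (l := l)) := by
  constructor
  · intro I J h
    apply Subtype.ext
    rw [eq_profileIdeal_coords hl I, h, ← eq_profileIdeal_coords hl J]
  · intro p
    exact ⟨⟨profileIdeal p, isProperIdeal_profileIdeal hl p⟩, coords_of_eq hl _ p rfl⟩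

theorem stringOf_bijOn (hl : 3 ≤ l) : Set.BijOn (stringOf (l := l))
    {F | IsProperIdeal (label (l := l)) F ∧ height F = 0} Set.univ := by
  refine ⟨fun _ _ => Set.mem_univ _, ?_, ?_⟩
  · rintro F ⟨hF, hF0⟩ G ⟨hG, hG0⟩ h
    obtain ⟨⟨t, f⟩, rfl⟩ := exists_eq_profileIdeal hF
    obtain ⟨⟨u, g⟩, rfl⟩ := exists_eq_profileIdeal hG
    rw [height_profileIdeal hl] at hF0 hG0
    dsimp only at hF0 hG0
    subst hF0 hG0
    rw [stringOf_profileIdeal hl, stringOf_profileIdeal hl] at h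
    rw [h]
  · intro f _
    exact ⟨profileIdeal (0, f), ⟨isProperIdeal_profileIdeal hl _, height_profileIdeal hl _⟩,
      stringOf_profileIdeal hl f⟩

end Profile

/-! ### The operators `S_i` in coordinates -/

section Reflect

variable {l : ℕ}

theorem column_eq_of_label_eq {a b : SpinHeap l} (h : label a = label b) : (a.x : ℕ) = b.x := by
  have ha := label_cases a
  have hb := label_cases b
  rw [Fin.ext_iff] at h
  omega

theorem le_total_of_label_eq (hl : 3 ≤ l) {a b : SpinHeap l} (h : label a = label b) :
    a ≤ b ∨ b ≤ a :=
  (isLabelledHeap hl).comparable a b (Or.inl h)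

theorem reflect_of_removable (hl : 3 ≤ l) {I : Set (SpinHeap l)} {c : SpinHeap l}
    (hc : c ∈ I) (h : IsLowerSet (I \ {c})) : reflect label (label c) I = I \ {c} := by
  have hrem : removable label (label c) I = {c} := by
    ext a
    constructor
    · rintro ⟨hac, haI, ha⟩
      by_contra hne
      rcases le_total_of_label_eq hl hac with hle | hle
      · exact (ha hle ⟨hc, fun e => hne (Eq.symm e)⟩).2 rfl
      · exact (h hle ⟨haI, hne⟩).2 rfl
    · rintro rfl
      exact ⟨rfl, hc, h⟩
  rw [reflect, hrem, if_pos (Set.singleton_nonempty c)]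

/-- Since `reflect` prefers removal, it must be ruled out that another element `b` with the label of
`c` is removable. Such a `b` lies below `c`, and a cover of `b` below `c` is in another column than
`c`, hence already in `I`, which blocks the removal of `b`. -/
theorem reflect_of_addable (hl : 3 ≤ l) {I : Set (SpinHeap l)} {c : SpinHeap l}
    (hI : IsLowerSet I) (hc : c ∉ I) (h : IsLowerSet (I ∪ {c})) :
    reflect label (label c) I = I ∪ {c} := by
  have hadd : addable label (label c) I = {c} := by
    ext a
    constructor
    · rintro ⟨hac, haI, ha⟩
      by_contra hne
      rcases le_total_of_label_eq hl hac with hle | hle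
      · exact (h hle (Or.inr rfl)).elim haI hne
      · exact (ha hle (Or.inr rfl)).elim hc fun e => hne (Eq.symm e)
    · rintro rfl
      exact ⟨rfl, hc, h⟩
  have hrem : ¬ (removable label (label c) I).Nonempty := by
    rintro ⟨b, hbc, hbI, hb⟩
    have hle : b ≤ c := (le_total_of_label_eq hl hbc).resolve_right fun hle => hc (hI hle hbI)
    have hlt : b < c := lt_of_le_of_ne hle fun e => hc (e ▸ hbI)
    obtain ⟨d, hdy, hdx, hdc⟩ := exists_step hl hlt
    have hbd : b < d := (covBy_of_column b d hdx hdy).lt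
    have hcol := column_eq_of_label_eq hbc
    have hdI : d ∈ I := by
      refine (h hdc (Or.inr rfl)).resolve_right ?_
      rintro rfl
      omega
    exact (hb hbd.le ⟨hdI, hbd.ne'⟩).2 rfl
  rw [reflect, hadd, if_neg hrem, if_pos (Set.singleton_nonempty c)]

/-- Lowering one column top by `2` removes exactly one point, and what remains is an ideal because
it is again a profile ideal. -/
theorem reflect_profileIdeal_sub (hl : 3 ≤ l) (p q : ℤ × SignString l) (x : ℕ) (hx : x < l)
    (i : Fin (l + 1)) (hi : label (point x (profile p x) hx (profile_parity p hx)) = i)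
    (h : ∀ n < l, profile q n = profile p n - if n = x then 2 else 0) :
    reflect label i (profileIdeal p) = profileIdeal q := by
  have hq : profileIdeal q = profileIdeal p \ {point x (profile p x) hx (profile_parity p hx)} := by
    ext a
    have hp := profile_parity p a.x.2
    have ha := a.parity
    rw [Set.mem_sdiff, Set.mem_singleton_iff, mem_profileIdeal, mem_profileIdeal, h _ a.x.2, eq_iff,
      point_x, point_y]
    split_ifs with hax
    · rw [hax] at hp ⊢
      omega
    · omega
  rw [← hi, hq]
  refine reflect_of_removable hl ((mem_profileIdeal _ _).2 le_rfl) ?_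
  rw [← hq]
  exact isLowerSet_profileIdeal q

theorem reflect_profileIdeal_add (hl : 3 ≤ l) (p q : ℤ × SignString l) (x : ℕ) (hx : x < l)
    (i : Fin (l + 1))
    (hi : label (point x (profile p x + 2) hx (by have := profile_parity p hx; omega)) = i)
    (h : ∀ n < l, profile q n = profile p n + if n = x then 2 else 0) :
    reflect label i (profileIdeal p) = profileIdeal q := by
  have hq : profileIdeal q = profileIdeal p ∪
      {point x (profile p x + 2) hx (by have := profile_parity p hx; omega)} := by
    ext a
    have hp := profile_parity p a.x.2
    have ha := a.parity
    rw [Set.mem_union, Set.mem_singleton_iff, mem_profileIdeal, mem_profileIdeal, h _ a.x.2, eq_iff,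
      point_x, point_y]
    split_ifs with hax
    · rw [hax] at hp ⊢
      omega
    · omega
  rw [← hi, hq]
  refine reflect_of_addable hl (isLowerSet_profileIdeal p) ?_ ?_
  · rw [mem_profileIdeal, point_x, point_y]
    omega
  · rw [← hq]
    exact isLowerSet_profileIdeal q

theorem removable_profileIdeal {p : ℤ × SignString l} {i : Fin (l + 1)} {a : SpinHeap l}
    (h : a ∈ removable label i (profileIdeal p)) : a.y = profile p a.x ∧
      ∀ n < l, (n = a.x + 1 ∨ n + 1 = a.x) → profile p n ≤ a.y := by
  obtain ⟨-, haI, ha⟩ := h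
  have hap := a.parity
  have hp := profile_parity p a.x.2
  have key : ∀ b : SpinHeap l, a < b → b ∉ profileIdeal p := fun b hab hb =>
    (ha hab.le ⟨hb, hab.ne'⟩).2 rfl
  rw [mem_profileIdeal] at haI
  constructor
  · have := key (point a.x (a.y + 2) a.x.2 (by omega)) (by
      rw [lt_iff, le_iff, point_x, point_y]
      omega)
    rw [mem_profileIdeal, point_x, point_y] at this
    omega
  · intro n hn hnx
    have := key (point n (a.y + 1) hn (by omega)) (by
      rw [lt_iff, le_iff, point_x, point_y]
      omega)
    rw [mem_profileIdeal, point_x, point_y] at this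
    omega

theorem addable_profileIdeal {p : ℤ × SignString l} {i : Fin (l + 1)} {a : SpinHeap l}
    (h : a ∈ addable label i (profileIdeal p)) : a.y = profile p a.x + 2 ∧
      ∀ n < l, (n = a.x + 1 ∨ n + 1 = a.x) → a.y ≤ profile p n + 1 := by
  obtain ⟨-, haI, ha⟩ := h
  have hap := a.parity
  have hp := profile_parity p a.x.2
  have key : ∀ b : SpinHeap l, b < a → b ∈ profileIdeal p := fun b hab =>
    (ha hab.le (Or.inr rfl)).resolve_right hab.ne
  rw [mem_profileIdeal] at haI
  constructor
  · have := key (point a.x (a.y - 2) a.x.2 (by omega)) (by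
      rw [lt_iff, le_iff, point_x, point_y]
      omega)
    rw [mem_profileIdeal, point_x, point_y] at this
    omega
  · intro n hn hnx
    have := key (point n (a.y - 1) hn (by omega)) (by
      rw [lt_iff, le_iff, point_x, point_y]
      omega)
    rw [mem_profileIdeal, point_x, point_y] at this
    omega

/-- A generator moves the path in a single column, by the coroot pairing. The truncated `i - 1`
sends both `i = 0` and `i = 1` to column `0`. For `i = 0` the change of `4t` compensates the sign
changes in all later columns. -/
theorem profile_pairStep (hl : 3 ≤ l) (i : Fin (l + 1)) (p : ℤ × SignString l) (n : ℕ)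
    (hn : n < l) : profile (pairStep hl i p) n =
      profile p n - if n = (i : ℕ) - 1 then affineCoroot l i (weight p) else 0 := by
  obtain ⟨i, hi⟩ := i
  have ht := two_mul_pairStep_fst hl ⟨i, hi⟩ p
  have hs := symbol_pairStep hl ⟨i, hi⟩ p
  generalize pairStep hl ⟨i, hi⟩ p = q at ht hs
  have hw : ∀ m < l, weight p m = symbol p.2 m := fun m hm => if_neg hm.ne
  have h0 := hw 0 (by omega)
  have h1 := hw 1 (by omega)
  rw [affineCoroot_apply]
  dsimp only at ht hs ⊢
  by_cases hi0 : i = 0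
  · subst hi0
    simp only [if_true, h0, h1] at ht hs ⊢
    induction n with
    | zero =>
      have hs0 := hs 0
      simp only [if_true] at hs0 ⊢
      rw [profile_zero, profile_zero, hs0]
      omega
    | succ n ih =>
      rw [profile_succ, profile_succ, ih (by omega), hs]
      grind
  by_cases hil : i = l
  · have h2 := hw (l - 1) (by omega)
    simp only [if_neg hi0, if_pos hil, h2] at ht hs ⊢
    induction n with
    | zero =>
      rw [profile_zero, profile_zero, hs]
      grind
    | succ n ih =>
      rw [profile_succ, profile_succ, ih (by omega), hs]
      grind
  · have h2 := hw (i - 1) (by omega)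
    have h3 := hw i (by omega)
    simp only [if_neg hi0, if_neg hil, h2, h3] at ht hs ⊢
    induction n with
    | zero =>
      rw [profile_zero, profile_zero, hs]
      grind
    | succ n ih =>
      rw [profile_succ, profile_succ, ih (by omega), hs]
      grind

theorem profileIdeal_congr {p q : ℤ × SignString l} (h : ∀ n < l, profile p n = profile q n) :
    profileIdeal p = profileIdeal q := by
  ext a
  rw [mem_profileIdeal, mem_profileIdeal, h _ a.x.2]

theorem reflect_profileIdeal (hl : 3 ≤ l) (i : Fin (l + 1)) (p : ℤ × SignString l) :
    reflect label i (profileIdeal p) = profileIdeal (pairStep hl i p) := by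
  have hq := profile_pairStep hl i p
  have hw : ∀ m < l, weight p m = symbol p.2 m := fun m hm => if_neg hm.ne
  have hs : ∀ m < l, symbol p.2 m = 1 ∨ symbol p.2 m = -1 := fun m hm => symbol_eq_or p.2 hm
  obtain ⟨i, hi⟩ := i
  dsimp only at hq
  have hc := affineCoroot_apply l i (weight p)
  generalize affineCoroot l i (weight p) = c at hq hc
  have hc0 : i = 0 → c = -symbol p.2 0 - symbol p.2 1 := by
    intro h
    rw [hc, if_pos h, hw 0 (by omega), hw 1 (by omega)]
  have hc1 : i = 1 → c = symbol p.2 0 - symbol p.2 1 := by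
    intro h
    rw [hc, if_neg (by omega), if_neg (by omega), h, hw _ (by omega), hw _ (by omega)]
  have hcl : i = l → c = 2 * symbol p.2 (l - 1) := by
    intro h
    rw [hc, if_neg (by omega), if_pos h, hw _ (by omega)]
  have hci : i ≠ 0 → i ≠ l → c = symbol p.2 (i - 1) - symbol p.2 i := by
    intro h h'
    rw [hc, if_neg h, if_neg h', hw _ (by omega), hw _ (by omega)]
  have hs0 := hs 0 (by omega)
  have hs1 := hs 1 (by omega)
  have hsl := hs (l - 1) (by omega)
  have hsi := hs (i - 1) (by omega)
  have hsi' := hs i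
  have hp0 := profile_zero p
  have hp1 := profile_succ p 0
  have hpi : i ≤ 1 → profile p (i - 1) = profile p 0 := by
    intro h
    rw [show i - 1 = 0 by omega]
  have hpi' : i ≠ 0 → profile p i = profile p (i - 1) + symbol p.2 i := by
    intro h
    obtain ⟨k, rfl⟩ := Nat.exists_eq_succ_of_ne_zero h
    exact profile_succ p k
  have hpi'' : 2 ≤ i → profile p (i - 1) = profile p (i - 2) + symbol p.2 (i - 1) := by
    intro h
    obtain ⟨k, rfl⟩ := Nat.exists_eq_add_of_le' h
    exact profile_succ p k
  rw [zero_add] at hp1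
  clear hc hw hs
  -- For `c = 2` the top of column `i - 1` is removed, and for `c = -2` a point is added above it.
  -- In column `0` the residue of the height modulo `4` confirms the label.
  by_cases c2 : c = 2
  · subst c2
    refine reflect_profileIdeal_sub hl p _ (i - 1) (by omega) _ ?_ hq
    rw [label_eq_iff, point_x, point_y]
    dsimp only
    omega
  by_cases c2' : c = -2
  · subst c2'
    refine reflect_profileIdeal_add hl p _ (i - 1) (by omega) _ ?_ fun n hn => ?_
    · rw [label_eq_iff, point_x, point_y]
      dsimp only
      omega
    · rw [hq n hn]
      split_ifs <;> ring
  have c0 : c = 0 := by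
    clear hpi hpi' hpi'' hq hp0 hp1 hc1
    by_cases h0 : i = 0
    · have := hc0 h0
      clear hc0 hcl hci hsi' hsi hsl
      omega
    by_cases h1 : i = l
    · have := hcl h1
      clear hc0 hcl hci hsi' hsi
      omega
    · have := hci h0 h1
      have := hsi' (by omega)
      clear hc0 hcl hci hsi' hs0 hs1 hsl
      omega
  subst c0
  have hcases : (i = 0 ∧ symbol p.2 0 = -symbol p.2 1) ∨ (i = 1 ∧ symbol p.2 0 = symbol p.2 1) ∨
      (2 ≤ i ∧ i < l ∧ symbol p.2 (i - 1) = symbol p.2 i) := by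
    clear hpi hpi' hpi'' hq hp0 hp1
    omega
  clear hc0 hc1 hcl hci hsl hsi' c2 c2'
  -- With `c = 0` and `i ≥ 2` the path runs straight through column `i - 1`: one neighbouring column
  -- is higher and blocks removal, the other is lower and blocks addition. In column `0` an
  -- obstruction comes either from the label or from column `1`.
  have hrem : ¬ (removable label ⟨i, hi⟩ (profileIdeal p)).Nonempty := by
    rintro ⟨a, ha⟩
    obtain ⟨hy, hn⟩ := removable_profileIdeal ha
    have hlab := (label_eq_iff _ _).1 ha.1
    have hn1 := hn 1 (by omega)
    have hni := hn i
    have hni' := hn (i - 2) (by omega)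
    dsimp only at hlab
    have hax : (a.x : ℕ) = i - 1 := by omega
    rw [hax] at hy hlab hn1 hni hni'
    clear hn hq ha
    rcases hcases with ⟨rfl, h⟩ | ⟨rfl, h⟩ | ⟨hi2, hil, h⟩
    · have h1 := hpi (by omega)
      clear hpi hpi' hpi'' hni hni' hsi
      omega
    · have h1 := hpi (by omega)
      clear hpi hpi' hpi'' hni hni' hsi
      omega
    · have h1 := hpi' (by omega)
      have h2 := hpi'' hi2
      have h3 := hni hil (by omega)
      have h4 := hni' (by omega)
      clear hpi hpi' hpi'' hni hni' hn1
      omega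
  have hadd : ¬ (addable label ⟨i, hi⟩ (profileIdeal p)).Nonempty := by
    rintro ⟨a, ha⟩
    obtain ⟨hy, hn⟩ := addable_profileIdeal ha
    have hlab := (label_eq_iff _ _).1 ha.1
    have hn1 := hn 1 (by omega)
    have hni := hn i
    have hni' := hn (i - 2) (by omega)
    dsimp only at hlab
    have hax : (a.x : ℕ) = i - 1 := by omega
    rw [hax] at hy hlab hn1 hni hni'
    clear hn hq ha
    rcases hcases with ⟨rfl, h⟩ | ⟨rfl, h⟩ | ⟨hi2, hil, h⟩
    · have h1 := hpi (by omega)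
      clear hpi hpi' hpi'' hni hni' hsi
      omega
    · have h1 := hpi (by omega)
      clear hpi hpi' hpi'' hni hni' hsi
      omega
    · have h1 := hpi' (by omega)
      have h2 := hpi'' hi2
      have h3 := hni hil (by omega)
      have h4 := hni' (by omega)
      clear hpi hpi' hpi'' hni hni' hn1
      omega
  rw [reflect, if_neg hrem, if_neg hadd]
  refine profileIdeal_congr fun n hn => ?_
  rw [hq n hn]
  split_ifs <;> ring

end Reflect

/-! ### The induced actions on ideals and strings -/

section Actions

variable {l : ℕ}

/-- The bijection between proper ideals and pairs. -/
noncomputable def coordsEquiv (hl : 3 ≤ l) : Ideals l ≃ ℤ × SignString l :=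
  Equiv.ofBijective coords (coords_bijective hl)

/-- The action of the affine Weyl group on proper ideals. -/
noncomputable def idealAction (hl : 3 ≤ l) : AffineWeyl l →* Equiv.Perm (Ideals l) :=
  (coordsEquiv hl).symm.permCongrHom.toMonoidHom.comp (pairAction hl)

theorem coords_idealAction (hl : 3 ≤ l) (w : AffineWeyl l) (I : Ideals l) :
    coords (idealAction hl w I) = pairAction hl w (coords I) :=
  (coordsEquiv hl).apply_symm_apply _

theorem idealAction_s (hl : 3 ≤ l) (i : Fin (l + 1)) (I : Ideals l) :
    (idealAction hl (s i) I).1 = reflect label i I.1 := by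
  rw [eq_profileIdeal_coords hl (idealAction hl (s i) I), coords_idealAction, pairAction_s_apply,
    ← reflect_profileIdeal, ← eq_profileIdeal_coords hl]

/-- The action of the finite Weyl group on strings. -/
noncomputable def stringAction (hl : 3 ≤ l) : finiteWeyl l →* Equiv.Perm (SignString l) where
  toFun w :=
    { toFun := fun f => (pairAction hl w (0, f)).2
      invFun := fun f => (pairAction hl (w⁻¹ : finiteWeyl l) (0, f)).2
      left_inv := fun f => by
        dsimp only
        rw [← pairAction_finite hl w.2, Subgroup.coe_inv, map_inv]
        exact congrArg Prod.snd ((pairAction hl w).symm_apply_apply (0, f))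
      right_inv := fun f => by
        dsimp only
        rw [← pairAction_finite hl w⁻¹.2, Subgroup.coe_inv, map_inv]
        exact congrArg Prod.snd ((pairAction hl w).apply_symm_apply (0, f)) }
  map_one' := by
    ext1 f
    simp
  map_mul' v w := by
    ext1 f
    change (pairAction hl (v * w : finiteWeyl l) (0, f)).2 =
      (pairAction hl v (0, (pairAction hl w (0, f)).2)).2
    rw [Subgroup.coe_mul, map_mul, Equiv.Perm.mul_apply, ← pairAction_finite hl w.2]

theorem stringAction_apply (hl : 3 ≤ l) (w : finiteWeyl l) (f : SignString l) :
    stringAction hl w f = (pairAction hl w (0, f)).2 := rfl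

theorem pairAction_coe (hl : 3 ≤ l) (w : finiteWeyl l) (t : ℤ) (f : SignString l) :
    pairAction hl w (t, f) = (t, stringAction hl w f) :=
  pairAction_finite hl w.2 t f

/-- `W_0` acts in the same way on every slice of constant `t`, so triviality on strings is
triviality on pairs. -/
theorem stringAction_injective (hl : 3 ≤ l) : Function.Injective (stringAction hl) := by
  rw [injective_iff_map_eq_one]
  intro w hw
  apply Subtype.ext
  apply pairAction_injective hl
  rw [OneMemClass.coe_one, map_one]
  ext1 ⟨t, f⟩
  rw [pairAction_coe, hw]
  rfl

theorem stringAction_swap (hl : 3 ≤ l) (i j : Fin l) (hij : (i : ℕ) + 1 = j) (f : SignString l) :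
    stringAction hl (s₀ i) f = f ∘ Equiv.swap i j := by
  obtain ⟨i, hi⟩ := i
  obtain ⟨j, hj⟩ := j
  dsimp only at hij
  subst hij
  rw [stringAction_apply]
  change (pairAction hl (s (Fin.succ ⟨i, hi⟩)) (0, f)).2 = _
  rw [pairAction_s_apply]
  simp only [pairStep, Fin.succ_mk]
  rw [if_neg (by omega), dif_neg (by omega)]
  rfl

theorem stringAction_update (hl : 3 ≤ l) (i : Fin l) (hi : (i : ℕ) + 1 = l) (f : SignString l) :
    stringAction hl (s₀ i) f = Function.update f i (-f i) := by
  have hil : i = ⟨l - 1, by omega⟩ := Fin.ext (by dsimp only; omega)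
  rw [stringAction_apply]
  change (pairAction hl (s i.succ) (0, f)).2 = _
  rw [pairAction_s_apply]
  simp only [pairStep, Fin.val_succ]
  rw [if_neg (by omega), dif_pos hi, ← hil]

/-- Every change of a single symbol of strings is given by an element of the finite Weyl group. -/
theorem exists_stringAction_update (hl : 3 ≤ l) (i : Fin l) :
    ∃ w : finiteWeyl l, ∀ f : SignString l, stringAction hl w f = Function.update f i (-f i) := by
  obtain ⟨k, hk⟩ : ∃ k, (i : ℕ) + 1 + k = l := ⟨l - (i + 1), by omega⟩
  induction k generalizing i with
  | zero => exact ⟨s₀ i, stringAction_update hl i hk⟩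
  | succ k ih =>
    let j : Fin l := ⟨i + 1, by omega⟩
    obtain ⟨w, hw⟩ := ih j (by simp only [j]; omega)
    have hij : i ≠ j := by simp [j, Fin.ext_iff]
    -- Conjugating the sign change at position `i + 1` by the exchange of `i` and `i + 1` moves it
    -- to `i`; the induction runs down from the last position.
    refine ⟨s₀ i * w * s₀ i, fun f => ?_⟩
    rw [map_mul, map_mul, Equiv.Perm.mul_apply, Equiv.Perm.mul_apply,
      stringAction_swap hl i j rfl, hw, stringAction_swap hl i j rfl]
    funext m
    simp only [Function.comp_apply, Function.update_apply, Equiv.swap_apply_right]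
    by_cases h1 : m = i
    · simp [h1]
    · by_cases h2 : m = j
      · simp [h2, hij, hij.symm]
      · simp [Equiv.swap_apply_of_ne_of_ne h1 h2, h1, h2]

/-- Single sign changes correct the positions where `f` and `g` differ, one at a time. -/
theorem stringAction_transitive (hl : 3 ≤ l) (f g : SignString l) :
    ∃ w : finiteWeyl l, stringAction hl w f = g := by
  have key : ∀ T : Finset (Fin l), ∃ w : finiteWeyl l,
      stringAction hl w f = fun i => if i ∈ T then g i else f i := by
    intro T
    induction T using Finset.induction_on with
    | empty => exact ⟨1, by simp⟩
    | insert i T hi ih =>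
      obtain ⟨w, hw⟩ := ih
      by_cases hfg : f i = g i
      · refine ⟨w, hw.trans (funext fun m => ?_)⟩
        by_cases hm : m = i <;> simp [hm, hi, hfg]
      · obtain ⟨u, hu⟩ := exists_stringAction_update hl i
        refine ⟨u * w, ?_⟩
        rw [map_mul, Equiv.Perm.mul_apply, hw, hu]
        funext m
        by_cases hm : m = i
        · subst hm
          rcases Int.units_eq_one_or (f m) with h1 | h1 <;>
            rcases Int.units_eq_one_or (g m) with h2 | h2 <;> simp_all
        · simp [hm]
  obtain ⟨w, hw⟩ := key Finset.univ
  exact ⟨w, by simpa using hw⟩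

theorem coords_of_height_eq_zero {I : Ideals l} (h : height I.1 = 0) :
    coords I = (0, stringOf I.1) := by
  have hid : SpinHeap.shift (l := l) (-0) = id := by
    funext a
    apply SpinHeap.ext
    · rfl
    · simp [shift]
  rw [coords, h, hid, Set.image_id]

theorem idealAction_height_zero (hl : 3 ≤ l) (w : finiteWeyl l) (I : Ideals l)
    (h : height I.1 = 0) : height (idealAction hl w I).1 = 0 ∧
      stringOf (idealAction hl w I).1 = stringAction hl w (stringOf I.1) := by
  have h1 := coords_idealAction hl w I
  rw [coords_of_height_eq_zero h, pairAction_coe] at h1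
  have h2 : height (idealAction hl w I).1 = 0 := congrArg Prod.fst h1
  rw [coords_of_height_eq_zero h2] at h1
  exact ⟨h2, congrArg Prod.snd h1⟩

/-- One formula for all four sign patterns of `s_0`: the first two symbols are swapped and negated.
-/
theorem pairAction_s_zero (hl : 3 ≤ l) (a b : Fin l) (ha : (a : ℕ) = 0) (hb : (b : ℕ) = 1) (t : ℤ)
    (f : SignString l) : pairAction hl (s 0) (t, f) = (t + (f a + f b : ℤ) / 2,
      Function.update (Function.update f a (-f b)) b (-f a)) := by
  obtain ⟨a, ha'⟩ := a
  obtain ⟨b, hb'⟩ := b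
  dsimp only at ha hb
  subst ha hb
  rw [pairAction_s_apply]
  simp only [pairStep, Fin.val_zero, if_true]
  congr 1
  funext m
  simp only [Function.update_apply]
  by_cases h : m = ⟨0, ha'⟩ <;> simp [h]

end Actions

end FullHeap

/-! ### Assembly of the proposition -/

open FullHeap
theorem proposition7p8 (l : ℕ) (hl : 3 ≤ l) :
    -- the spin heap is a full heap of type `B_l^{(1)}`
    IsFull (cartanAffineB l) (SpinHeap.label (l := l)) ∧
    -- `W_0` is the Weyl group of type `B_l`
    (∃ e : (CoxeterMatrix.B l).Group ≃* finiteWeyl l,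
      ∀ i : Fin l, e ((CoxeterMatrix.B l).simple i) = s₀ i) ∧
    -- the ideals of height `0` correspond to strings, all proper ideals to pairs `(t, string)`
    Set.BijOn (stringOf (l := l))
      {F | IsProperIdeal (SpinHeap.label (l := l)) F ∧ SpinHeap.height F = 0} Set.univ ∧
    Function.Bijective (coords (l := l)) ∧
    -- the action of `W` on proper ideals
    ∃ ρ : AffineWeyl l →* Equiv.Perm (Ideals l),
      (∀ (i : Fin (l + 1)) (I : Ideals l),
        (ρ (s i) I).1 = reflect (SpinHeap.label (l := l)) i I.1) ∧
      -- the induced action of `W_0` on strings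
      ∃ ρ₀ : finiteWeyl l →* Equiv.Perm (SignString l),
        (∀ (w : finiteWeyl l) (I : Ideals l), SpinHeap.height I.1 = 0 →
          SpinHeap.height (ρ w I).1 = 0 ∧ stringOf (ρ w I).1 = ρ₀ w (stringOf I.1)) ∧
        (∀ f g : SignString l, ∃ w : finiteWeyl l, ρ₀ w f = g) ∧
        Function.Injective ρ₀ ∧
        (∀ i j : Fin l, (i : ℕ) + 1 = j → ∀ f : SignString l,
          ρ₀ (s₀ i) f = f ∘ Equiv.swap i j) ∧
        (∀ i : Fin l, (i : ℕ) + 1 = l → ∀ f : SignString l,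
          ρ₀ (s₀ i) f = Function.update f i (-f i)) ∧
        -- the induced action of `W` on pairs
        ∃ ρ₁ : AffineWeyl l →* Equiv.Perm (ℤ × SignString l),
          (∀ (w : AffineWeyl l) (I : Ideals l), coords (ρ w I) = ρ₁ w (coords I)) ∧
          Function.Injective ρ₁ ∧
          (∀ (w : finiteWeyl l) (t : ℤ) (f : SignString l), ρ₁ w (t, f) = (t, ρ₀ w f)) ∧
          (∀ a b : Fin l, (a : ℕ) = 0 → (b : ℕ) = 1 → ∀ (t : ℤ) (f : SignString l),
            (f a = 1 → f b = 1 →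
              ρ₁ (s 0) (t, f) = (t + 1, Function.update (Function.update f a (-1)) b (-1))) ∧
            (f a = -1 → f b = -1 →
              ρ₁ (s 0) (t, f) = (t - 1, Function.update (Function.update f a 1) b 1)) ∧
            (f a = 1 → f b = -1 → ρ₁ (s 0) (t, f) = (t, f)) ∧
            (f a = -1 → f b = 1 → ρ₁ (s 0) (t, f) = (t, f))) := by
  refine ⟨SpinHeap.isFull hl, exists_mulEquiv_finiteWeyl l hl, stringOf_bijOn hl,
    coords_bijective hl, idealAction hl, idealAction_s hl, stringAction hl,
    idealAction_height_zero hl, stringAction_transitive hl, stringAction_injective hl,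
    stringAction_swap hl, stringAction_update hl, pairAction hl, coords_idealAction hl,
    pairAction_injective hl, pairAction_coe hl, fun a b ha hb t f => ?_⟩
  have hab : a ≠ b := by
    rintro rfl
    omega
  rw [pairAction_s_zero hl a b ha hb]
  refine ⟨fun h1 h2 => ?_, fun h1 h2 => ?_, fun h1 h2 => ?_, fun h1 h2 => ?_⟩
  · simp [h1, h2]
  · simp [h1, h2, sub_eq_add_neg]
  -- Opposite symbols are unchanged when swapped and negated, and their sum is `0`.
  all_goals
    have h : Function.update (Function.update f a (-f b)) b (-f a) = f := by
      rw [h1, h2]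
      funext m
      simp only [Function.update_apply]
      split_ifs with hm hm' <;> simp [*]
    rw [h]
    simp [h1, h2]
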